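/- Let $d,M_d\ge 1$ be fixed. Consider a state-space model with signal in $\mathbb{R}^d$ started at a known $x_0$, with transition density $f(x,x')\ge 0$ and observation density $g(x,y)\ge 0$, both measurable, and fix a data record $y_1,y_2,\ldots\in\mathbb{R}^{d_y}$. Suppose that for every $k\ge1$ $$g(x_k,y_k)f(x_{k-1},x_k)=\prod_{j=1}^d\alpha_{k,j}(y_k,x_{k-1},x_k(1{:}j)),$$ where $x(1{:}j)$ denotes the first $j$ coordinates of $x$ and the $\alpha_{k,j}\ge0$ are measurable. Let $q_{k,j}(\cdot\mid x_k(1{:}j-1),x_{k-1})$ be (measurable) conditional probability densities on $\mathbb{R}$ such that $\alpha_{k,j}=0$ wherever $q_{k,j}=0$, and set $$G_{k,j}(x_{k-1},x_k(1{:}j))=\frac{\alpha_{k,j}(y_k,x_{k-1},x_k(1{:}j))}{q_{k,j}(x_k(j)\mid x_k(1{:}j-1),x_{k-1})},\qquad \text{with } 0/0=0.$$ At $k=1$ the state $x_{k-1}$ is always the fixed $x_0$. Assume $\sup_{u\in\mathbb{R}^j}|G_{1,j}(x_0,u)|<\infty$ for $1\le j\le d$, and $\sup_{x\in\mathbb{R}^d,\,u\in\mathbb{R}^j}|G_{n,j}(x,u)|<\infty$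 for $n\ge2$ and $1\le j\le d$. The space-time particle filter with $N$ islands of $M_d$ particles runs as follows. Set $\check x_0^{i,l}=x_0$. At time $k\ge1$, independently for each island $i\in\{1,\dots,N\}$, a local filter starts from the $M_d$ particles $\check x_{k-1}^{i,1},\dots,\check x_{k-1}^{i,M_d}$. For $j=1,\dots,d$ it draws for each particle $l$ the $j$-th coordinate from $q_{k,j}$ given the particle's first $j-1$ coordinates at time $k$ and its ancestor state at time $k-1$, computes the weight $G_{k,j}^{i,l}$, and resamples the $M_d$ particles (together with their ancestor states at time $k-1$) multinomially according to these weights. Island $i$ then gets the global weight $$\mathbf{G}_k^i=\prod_{j=1}^d\Big(\frac1{M_d}\sum_{l=1}^{M_d}G_{k,j}^{i,l}\Big),$$ and the $N$ islands are resampled multinomially according to the weights $\mathbf{G}_k^{1},\dots,\mathbf{G}_k^{N}$; the particles so obtained are denoted $\check x_k^{i,l}\in\mathbb{R}^d$. (If all weights in a resampling step vanish, the resampling is uniform.) Let $$p(y_{1:n})=\int_{\mathbb{R}^{nd}}\prod_{k=1}^n g(x_k,y_k)f(x_{k-1},x_k)\,dx_{1:n},\qquad \pi_n(\varphi)=\frac{1}{p(y_{1:n})}\int_{\mathbb{R}^{nd}}\varphi(x_n)\prod_{k=1}^n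 g(x_k,y_k)f(x_{k-1},x_k)\,dx_{1:n},$$ the latter when $p(y_{1:n})>0$. Then for every bounded measurable $\varphi:\mathbb{R}^d\to\mathbb{R}$ and every $n\ge2$, as $N\to\infty$, in probability under the law of the algorithm, $$\frac1{NM_d}\sum_{l=1}^{M_d}\sum_{i=1}^N\varphi(\check x_1^{i,l})\to\pi_1(\varphi),\qquad \frac1N\sum_{i=1}^N\mathbf{G}_1^i\to p(y_1),$$ $$\frac1{NM_d}\sum_{l=1}^{M_d}\sum_{i=1}^N\varphi(\check x_n^{i,l})\to\pi_n(\varphi),\qquad \prod_{k=1}^n\Big(\frac1N\sum_{i=1}^N\mathbf{G}_k^i\Big)\to p(y_{1:n}),$$ where the statement on $\pi_1(\varphi)$ is made when $p(y_1)>0$ and the one on $\pi_n(\varphi)$ when $p(y_{1:n})>0$. -/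

import Mathlib

open MeasureTheory Filter Topology

noncomputable section

namespace SpaceTime

/-- A state-space model with signal in `ℝ^d` and observations in `ℝ^dy`, conditioned on a fixed
data record, together with the factorization of the model along the space coordinates and the
proposal densities of the space-time particle filter.

Observation times are `k = 1, 2, …`; values at `k = 0` are never used.  Space coordinates are
numbered from `0`: for `j < d`, `α k j` and `q k j` are the functions that introduce the
coordinate of index `j` (the `(j+1)`-st coordinate).  Functions with `j ≥ d` are never used. -/
structure Model (d dy : ℕ) where
  /-- `f x x'` is the transition density of the signal (its normalization is not required). -/
  f : (Fin d → ℝ) → (Fin d → ℝ) → ℝ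
  /-- `g x v` is the density of the observation `v` given the signal `x` (its normalization is
  not required). -/
  g : (Fin d → ℝ) → (Fin dy → ℝ) → ℝ
  /-- the known initial position of the signal -/
  x0 : Fin d → ℝ
  /-- the data record; `y k` is observed at time `k ≥ 1` -/
  y : ℕ → (Fin dy → ℝ)
  /-- `α k j v x u`: the factor of the model that depends on the observation `v = y k`, the
  previous state `x` and the first `j + 1` coordinates `u` of the current state -/
  α : ℕ → (j : ℕ) → (Fin dy → ℝ) → (Fin d → ℝ) → (Fin (j + 1) → ℝ) → ℝ
  /-- `q k j x u t`: the proposal density, at `t`, of the next coordinate given the previous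
  state `x` and the first `j` coordinates `u` of the current state -/
  q : ℕ → (j : ℕ) → (Fin d → ℝ) → (Fin j → ℝ) → ℝ → ℝ
  f_nonneg : ∀ x x', 0 ≤ f x x'
  f_measurable : Measurable fun p : (Fin d → ℝ) × (Fin d → ℝ) => f p.1 p.2
  g_nonneg : ∀ x v, 0 ≤ g x v
  g_measurable : ∀ v, Measurable fun x => g x v
  α_nonneg : ∀ k j, 1 ≤ k → j < d → ∀ x u, 0 ≤ α k j (y k) x u
  α_measurable : ∀ k j, 1 ≤ k → j < d →
    Measurable fun p : (Fin d → ℝ) × (Fin (j + 1) → ℝ) => α k j (y k) p.1 p.2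
  q_nonneg : ∀ k j, 1 ≤ k → j < d → ∀ x u t, 0 ≤ q k j x u t
  q_measurable : ∀ k j, 1 ≤ k → j < d →
    Measurable fun p : ((Fin d → ℝ) × (Fin j → ℝ)) × ℝ => q k j p.1.1 p.1.2 p.2
  q_density : ∀ k j, 1 ≤ k → j < d → ∀ x u, ∫⁻ t : ℝ, ENNReal.ofReal (q k j x u t) = 1
  /-- The proposals dominate the factors, so that the weights `α / q` make sense.  At time `1`
  the previous state is `x0`. -/
  α_support : ∀ k j, 1 ≤ k → j < d → ∀ x u t, (k = 1 → x = x0) →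
    q k j x u t = 0 → α k j (y k) x (Fin.snoc (α := fun _ => ℝ) u t) = 0
  /-- `g(x_k, y_k) f(x_{k-1}, x_k) = ∏_j α_{k,j}(y_k, x_{k-1}, x_k(1:j))`. -/
  factor : ∀ k, 1 ≤ k → ∀ x x', (k = 1 → x = x0) →
    g x' (y k) * f x x' =
      ∏ j : Fin d, α k j (y k) x (fun i : Fin (j.1 + 1) => x' (Fin.castLE j.2 i))

namespace Model

variable {d dy : ℕ} (S : Model d dy)

/-! ### The exact quantities -/

/-- The path `(x_0, x_1, …, x_n)`, with the fixed initial position. -/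
def path {n : ℕ} (x : Fin n → Fin d → ℝ) : Fin (n + 1) → Fin d → ℝ :=
  Fin.cons (α := fun _ => Fin d → ℝ) S.x0 x

/-- `∏_{k=1}^n g(x_k, y_k) f(x_{k-1}, x_k)` as a function of `x_{1:n}`. -/
def jointDensity {n : ℕ} (x : Fin n → Fin d → ℝ) : ℝ :=
  ∏ k : Fin n, S.g (S.path x k.succ) (S.y (k + 1)) * S.f (S.path x k.castSucc) (S.path x k.succ)

/-- The normalizing constant `p(y_{1:n})`. -/
def normConst (n : ℕ) : ℝ :=
  ∫ x : Fin n → Fin d → ℝ, S.jointDensity x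

/-- The filter `π_n(φ)`. -/
def filter (n : ℕ) (φ : (Fin d → ℝ) → ℝ) : ℝ :=
  (∫ x : Fin n → Fin d → ℝ, φ (S.path x (Fin.last n)) * S.jointDensity x) / S.normConst n

/-- The weight `α / q` of the space-step that introduces the coordinate of index `j`. -/
def G (k j : ℕ) (x : Fin d → ℝ) (u : Fin (j + 1) → ℝ) : ℝ :=
  S.α k j (S.y k) x u /
    S.q k j x (fun i : Fin j => u i.castSucc) (u (Fin.last j))

end Model

/-! ### The algorithm -/

/-- The law of one draw from the points `x` with probabilities proportional to the nonnegative
weights `w`.  If all the weights vanish, the draw is uniform. -/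
def resample {ι E : Type*} [Fintype ι] [MeasurableSpace E] (w : ι → ℝ) (x : ι → E) :
    Measure E :=
  if ∑ l, ENNReal.ofReal (w l) = 0 then
    ∑ l, ((Fintype.card ι : ENNReal)⁻¹) • Measure.dirac (x l)
  else
    ∑ l, (ENNReal.ofReal (w l) / ∑ l', ENNReal.ofReal (w l')) • Measure.dirac (x l)

/-- Multinomial resampling: as many independent draws as there are points. -/
def multinomial {ι E : Type*} [Fintype ι] [MeasurableSpace E] (w : ι → ℝ) (x : ι → E) :
    Measure (ι → E) :=
  Measure.pi fun _ : ι => resample w x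

/-- A local particle after `j` space-steps: the previous state it descends from and the first `j`
coordinates of the current state. -/
abbrev LocalParticle (d j : ℕ) : Type := (Fin d → ℝ) × (Fin j → ℝ)

/-- The state of a local filter after `j` space-steps: the `M` weights of each of the steps made
so far, and the `M` particles after the last resampling. -/
abbrev LocalState (d M j : ℕ) : Type := (Fin j → Fin M → ℝ) × (Fin M → LocalParticle d j)

/-- The state of the algorithm after `n` time-steps with `N` particle systems (islands) of `M`
particles: the global weights of the `N` islands at each of the times `1, …, n`, and the islands
after the last global resampling. -/
abbrev GlobalState (d M N n : ℕ) : Type :=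
  (Fin n → Fin N → ℝ) × (Fin N → Fin M → Fin d → ℝ)

/-- The global weight `∏_j (1/M) ∑_l G_{k,j}` of an island from the local weights. -/
def globalWeight {d M : ℕ} (w : Fin d → Fin M → ℝ) : ℝ :=
  ∏ j, (1 / (M : ℝ)) * ∑ l, w j l

namespace Model

variable {d dy : ℕ} (S : Model d dy)

/-- The law with density `q_{k,j}` on `ℝ`, given a local particle. -/
def proposal (k j : ℕ) (p : LocalParticle d j) : Measure ℝ :=
  volume.withDensity fun t => ENNReal.ofReal (S.q k j p.1 p.2 t)

/-- A local particle extended by a new coordinate. -/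
def extend {j : ℕ} (p : LocalParticle d j) (t : ℝ) : LocalParticle d (j + 1) :=
  (p.1, Fin.snoc (α := fun _ => ℝ) p.2 t)

/-- One space-step of a local filter: propose the next coordinate of each particle, compute the
weights, and resample the particles together with their previous states. -/
def localStep (M k j : ℕ) (s : LocalState d M j) : Measure (LocalState d M (j + 1)) :=
  (Measure.pi fun l : Fin M => S.proposal k j (s.2 l)).bind fun t =>
    let x : Fin M → LocalParticle d (j + 1) := fun l => extend (s.2 l) (t l)
    let w : Fin M → ℝ := fun l => S.G k j (x l).1 (x l).2
    (multinomial w x).map fun x' => (Fin.snoc (α := fun _ => Fin M → ℝ) s.1 w, x')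

/-- The law of the local filter of time-step `k` after `j` space-steps, started from the island
`a` of states at time `k - 1`. -/
def localLaw (M k : ℕ) (a : Fin M → Fin d → ℝ) : (j : ℕ) → Measure (LocalState d M j)
  | 0 => Measure.dirac (Fin.elim0, fun l => (a l, Fin.elim0))
  | j + 1 => (localLaw M k a j).bind (S.localStep M k j)

/-- Time-step `n + 1` of the algorithm: run the local filters of the `N` islands independently
through all `d` coordinates, compute the global weights, and resample the islands. -/
def globalStep (M N n : ℕ) (s : GlobalState d M N n) : Measure (GlobalState d M N (n + 1)) :=
  (Measure.pi fun i : Fin N => S.localLaw M (n + 1) (s.2 i) d).bind fun z =>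
    let W : Fin N → ℝ := fun i => globalWeight (z i).1
    let x : Fin N → Fin M → Fin d → ℝ := fun i l => ((z i).2 l).2
    (multinomial W x).map fun x' => (Fin.snoc (α := fun _ => Fin N → ℝ) s.1 W, x')

/-- The law of the space-time particle filter with `N` islands of `M` particles after `n`
time-steps. -/
def law (M N : ℕ) : (n : ℕ) → Measure (GlobalState d M N n)
  | 0 => Measure.dirac (Fin.elim0, fun _ _ => S.x0)
  | n + 1 => (law M N n).bind (S.globalStep M N n)

end Model

/-- The filter estimate `(1/(N M)) ∑_l ∑_i φ(x_n^{i,l})`, after global resampling at time `n`. -/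
def filterEstimate {d M N n : ℕ} (φ : (Fin d → ℝ) → ℝ) (s : GlobalState d M N n) : ℝ :=
  (1 / ((N : ℝ) * M)) * ∑ l, ∑ i, φ (s.2 i l)

/-- The estimate `∏_{k=1}^n (1/N) ∑_i G_k^i` of the normalizing constant. -/
def normConstEstimate {d M N n : ℕ} (s : GlobalState d M N n) : ℝ :=
  ∏ k, (1 / (N : ℝ)) * ∑ i, s.1 k i

/-- Convergence in probability to a constant, as `N → ∞`, of random variables `T N` defined on
probability spaces that depend on `N`. -/
def TendstoInProbability {Ω : ℕ → Type*} [∀ N, MeasurableSpace (Ω N)]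
    (P : ∀ N, Measure (Ω N)) (T : ∀ N, Ω N → ℝ) (c : ℝ) : Prop :=
  ∀ ε : ℝ, 0 < ε → Tendsto (fun N => P N {ω | ε ≤ |T N ω - c|}) atTop (𝓝 0)

end SpaceTime

end

/-! Weight the particle average of a bounded measurable `ψ ≥ 0` at time `n` by the product of the
average global weights up to `n` (`unnormEstimate`). This estimates the integral of `ψ(x_n)` against
the unnormalized joint density, and the proof controls its first two moments.

Mean. Multiplying by the average weight removes the normalization of multinomial resampling: average
weight times expected resampled average equals the weighted average, even if all weights vanish.
Hence in expectation a space-step merely replaces the test function by its image under `spaceOp`,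
and a weighted island is exactly unbiased for any fixed number of particles (`lintegral_localLaw`).
Composing over time gives `lintegral_law_unnormEstimate`. The mean is the required integral because
the proposal density cancels against `α / q`, and Tonelli reassembles the coordinates and times
(`timeOps_eq`).

Variance. Given the past, the islands are independent; given the islands, the global draws are
independent. So the second moment exceeds the square of the mean only through diagonal terms, which
bounded weights make `O(1/N)` (`lintegral_globalStep_unnormEstimate_sq_le`). Iterating over the
fixed number of times keeps the excess at `K / N` (`lintegral_law_unnormEstimate_sq_le`). The
dependence between particles of one island never has to be analysed.

Chebyshev's inequality then gives convergence in probability. `ψ = 1` yields the normalizing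
constant, a quotient yields the filter, and a signed `φ` is first shifted by its bound. Moments are
computed in `ℝ≥0∞`, where no integrability is needed. -/

open scoped ENNReal

namespace SpaceTime

/-! ### Measurability of the transition kernels -/

section Measurability

variable {α β γ ι E V : Type*} [MeasurableSpace α] [MeasurableSpace β] [MeasurableSpace γ]
  [Fintype ι] [MeasurableSpace E] [MeasurableSpace V]

/-- The kernel composed after `κ` may depend on the starting point as well, as each step of the
algorithm needs; joint measurability then replaces that of a single kernel. -/
theorem measurable_bind_of_prod {κ : α → Measure β} (hκ : Measurable κ)
    (hκp : ∀ a, IsProbabilityMeasure (κ a)) {F : α → β → Measure γ}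
    (hF : Measurable fun p : α × β => F p.1 p.2) :
    Measurable fun a => (κ a).bind (F a) := by
  refine Measure.measurable_of_measurable_coe _ fun s hs => ?_
  let k : ProbabilityTheory.Kernel α β := ⟨κ, hκ⟩
  have : ProbabilityTheory.IsMarkovKernel k := ⟨hκp⟩
  have h : Measurable fun p : α × β => F p.1 p.2 s := (Measure.measurable_coe hs).comp hF
  have h2 := Measurable.lintegral_kernel_prod_right' (κ := k) h
  convert h2 using 2 with a
  have hFa : Measurable (F a) := hF.comp measurable_prodMk_left
  rw [Measure.bind_apply hs hFa.aemeasurable]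
  rfl

/-- For probability measures it suffices to test on the π-system of rectangles, where the product
measure is a finite product of measurable functions. -/
theorem measurable_pi_measure {κ : α → ι → Measure E} (hκ : ∀ i, Measurable fun a => κ a i)
    (hκp : ∀ a i, IsProbabilityMeasure (κ a i)) :
    Measurable fun a => Measure.pi (κ a) := by
  refine Measurable.measure_of_isPiSystem_of_isProbabilityMeasure
    generateFrom_pi.symm isPiSystem_pi ?_
  rintro _ ⟨s, hs, rfl⟩
  simp only [Set.mem_pi, Set.mem_univ, forall_true_left, Set.mem_ofPred_eq] at hs
  simp only [Measure.pi_pi]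
  exact Finset.measurable_prod _ fun i _ => (Measure.measurable_coe (hs i)).comp (hκ i)

theorem measurable_map_prodMk {κ : α → Measure E} (hκ : Measurable κ)
    (hκp : ∀ a, IsProbabilityMeasure (κ a)) {c : α → V} (hc : Measurable c) :
    Measurable fun a => (κ a).map (Prod.mk (c a)) := by
  have h : ∀ a, (κ a).map (Prod.mk (c a)) = (κ a).bind fun x => Measure.dirac (c a, x) := by
    intro a
    rw [Measure.bind_dirac_eq_map _ measurable_prodMk_left]
  simp only [h]
  exact measurable_bind_of_prod hκ hκp
    (Measure.measurable_dirac.comp ((hc.comp measurable_fst).prodMk measurable_snd))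

theorem measurable_resample {w : α → ι → ℝ} {x : α → ι → E} (hw : Measurable w)
    (hx : Measurable x) : Measurable fun a => resample (w a) (x a) := by
  have hw' : ∀ i, Measurable fun a => ENNReal.ofReal (w a i) := fun i => by fun_prop
  have hx' : ∀ i, Measurable fun a => Measure.dirac (x a i) := fun i =>
    Measure.measurable_dirac.comp (by fun_prop)
  have hsum : Measurable fun a => ∑ l, ENNReal.ofReal (w a l) :=
    Finset.measurable_sum _ fun i _ => hw' i
  unfold resample
  refine Measurable.ite (hsum (measurableSet_singleton 0)) ?_ ?_ <;>
  · refine Measure.measurable_of_measurable_coe _ fun s hs => ?_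
    simp only [Measure.coe_finsetSum, Finset.sum_apply, Measure.smul_apply, smul_eq_mul]
    refine Finset.measurable_sum _ fun i _ => Measurable.mul ?_
      ((Measure.measurable_coe hs).comp (hx' i))
    first
    | exact measurable_const
    | exact (hw' i).div hsum

variable [Nonempty ι]

instance isProbabilityMeasure_resample (w : ι → ℝ) (x : ι → E) :
    IsProbabilityMeasure (resample w x) := by
  constructor
  unfold resample
  split_ifs with h
  · simp only [Measure.coe_finsetSum, Finset.sum_apply, Measure.smul_apply, smul_eq_mul,
      measure_univ, mul_one, Finset.sum_const, Finset.card_univ, nsmul_eq_mul]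
    exact ENNReal.mul_inv_cancel (by simp) (by simp)
  · simp only [Measure.coe_finsetSum, Finset.sum_apply, Measure.smul_apply, smul_eq_mul,
      measure_univ, mul_one, div_eq_mul_inv, ← Finset.sum_mul]
    exact ENNReal.mul_inv_cancel h (ENNReal.sum_ne_top.2 fun _ _ => ENNReal.ofReal_ne_top)

instance isProbabilityMeasure_multinomial (w : ι → ℝ) (x : ι → E) :
    IsProbabilityMeasure (multinomial w x) := by
  unfold multinomial; infer_instance

theorem measurable_multinomial {w : α → ι → ℝ} {x : α → ι → E} (hw : Measurable w)
    (hx : Measurable x) : Measurable fun a => multinomial (w a) (x a) :=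
  measurable_pi_measure (fun _ => measurable_resample hw hx) fun _ _ => inferInstance

theorem measurable_map_multinomial {w : α → ι → ℝ} {x : α → ι → E} {c : α → V}
    (hw : Measurable w) (hx : Measurable x) (hc : Measurable c) :
    Measurable fun a => (multinomial (w a) (x a)).map (Prod.mk (c a)) :=
  measurable_map_prodMk (measurable_multinomial hw hx) (fun _ => inferInstance) hc

theorem isProbabilityMeasure_bind_of_forall {μ : Measure α} [IsProbabilityMeasure μ]
    {κ : α → Measure β} (hκ : Measurable κ) (hκp : ∀ a, IsProbabilityMeasure (κ a)) :
    IsProbabilityMeasure (μ.bind κ) := by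
  constructor
  rw [Measure.bind_apply MeasurableSet.univ hκ.aemeasurable]
  simp

end Measurability

/-! ### Almost sure invariants under resampling -/

section AlmostEverywhere

theorem measurableSet_forall {α ι : Type*} [MeasurableSpace α] [Countable ι] {p : ι → α → Prop}
    (h : ∀ i, MeasurableSet {a | p i a}) : MeasurableSet {a | ∀ i, p i a} := by
  have : {a | ∀ i, p i a} = ⋂ i, {a | p i a} := by ext; simp
  rw [this]
  exact MeasurableSet.iInter h

variable {α β ι E V : Type*} [MeasurableSpace α] [MeasurableSpace β]
  [Fintype ι] [MeasurableSpace E] [MeasurableSpace V]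

theorem ae_bind_of_ae {μ : Measure α} {κ : α → Measure β} (hκ : Measurable κ) {p : β → Prop}
    (hp : MeasurableSet {b | p b}) (h : ∀ᵐ a ∂μ, ∀ᵐ b ∂(κ a), p b) :
    ∀ᵐ b ∂(μ.bind κ), p b := by
  have hp' : MeasurableSet {b | ¬ p b} := hp.compl
  have hm : Measurable fun a => κ a {b | ¬ p b} := (Measure.measurable_coe hp').comp hκ
  rw [ae_iff, Measure.bind_apply hp' hκ.aemeasurable, lintegral_eq_zero_iff hm]
  filter_upwards [h] with a ha
  exact ha

theorem ae_resample {w : ι → ℝ} {x : ι → E} {p : E → Prop} (hp : MeasurableSet {e | p e})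
    (h : ∀ l, p (x l)) : ∀ᵐ e ∂(resample w x), p e := by
  have hd : ∀ l, (Measure.dirac (x l)) {e | ¬ p e} = 0 := fun l =>
    (ae_dirac_iff hp).2 (h l)
  rw [ae_iff]
  unfold resample
  split_ifs <;> simp [hd]

theorem ae_pi_forall {μ : ι → Measure E} [∀ i, IsProbabilityMeasure (μ i)] {p : ι → E → Prop}
    (h : ∀ i, ∀ᵐ e ∂(μ i), p i e) : ∀ᵐ z ∂(Measure.pi μ), ∀ i, p i (z i) :=
  ae_all_iff.2 fun i => (Measure.tendsto_eval_ae_ae (i := i)).eventually (h i)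

/-- Resampling only copies existing points, so a property of all candidates survives whatever the
weights are; the component `c` is the deterministic record of weights. -/
theorem ae_map_multinomial [Nonempty ι] {w : ι → ℝ} {x : ι → E} {c : V} {p : E → Prop}
    {r : V → Prop} (hp : MeasurableSet {e | p e}) (hr : MeasurableSet {v | r v})
    (h : ∀ l, p (x l)) (hc : r c) :
    ∀ᵐ s ∂((multinomial w x).map (Prod.mk c)), r s.1 ∧ ∀ l, p (s.2 l) := by
  have h0 : ∀ᵐ z ∂(multinomial w x), ∀ l, p (z l) :=
    ae_pi_forall fun _ => ae_resample hp h
  have hm : MeasurableSet {s : V × (ι → E) | r s.1 ∧ ∀ l, p (s.2 l)} :=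
    (hr.preimage measurable_fst).inter (measurableSet_forall fun l =>
      hp.preimage ((measurable_pi_apply l).comp measurable_snd))
  rw [ae_map_iff measurable_prodMk_left.aemeasurable hm]
  filter_upwards [h0] with z hz using ⟨hc, hz⟩

end AlmostEverywhere

/-! ### First and second moments of averages and of resampling -/

section Moments

variable {ι E : Type*} [Fintype ι] [MeasurableSpace E]

/-- The average of finitely many extended nonnegative numbers. -/
noncomputable def avg (v : ι → ℝ≥0∞) : ℝ≥0∞ := (Fintype.card ι : ℝ≥0∞)⁻¹ * ∑ i, v i

theorem measurable_avg {α : Type*} [MeasurableSpace α] {v : α → ι → ℝ≥0∞}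
    (hv : ∀ i, Measurable fun a => v a i) : Measurable fun a => avg (v a) :=
  (Finset.measurable_sum _ fun i _ => hv i).const_mul _

theorem avg_const [Nonempty ι] (B : ℝ≥0∞) : (avg fun _ : ι => B) = B := by
  simp only [avg, Finset.sum_const, Finset.card_univ, nsmul_eq_mul, ← mul_assoc]
  rw [ENNReal.inv_mul_cancel (by simp) (by simp), one_mul]

theorem avg_mono {v v' : ι → ℝ≥0∞} (h : ∀ i, v i ≤ v' i) : avg v ≤ avg v' := by
  unfold avg
  gcongr
  exact h _

theorem avg_le [Nonempty ι] {v : ι → ℝ≥0∞} {B : ℝ≥0∞} (h : ∀ i, v i ≤ B) : avg v ≤ B :=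
  (avg_mono h).trans_eq (avg_const B)

theorem lintegral_avg_pi {μ : ι → Measure E} [∀ i, IsProbabilityMeasure (μ i)]
    {f : ι → E → ℝ≥0∞} (hf : ∀ i, Measurable (f i)) :
    ∫⁻ z, avg (fun i => f i (z i)) ∂(Measure.pi μ) = avg fun i => ∫⁻ e, f i e ∂(μ i) := by
  have hfm : ∀ i, Measurable fun z : ι → E => f i (z i) := fun i =>
    (hf i).comp (measurable_pi_apply i)
  unfold avg
  rw [lintegral_const_mul _ (by fun_prop), lintegral_finsetSum _ (by fun_prop)]
  congr 2 with i
  exact (measurePreserving_eval μ i).lintegral_comp (hf i)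

theorem lintegral_mul_pi {μ : ι → Measure E} [∀ i, IsProbabilityMeasure (μ i)]
    {f : ι → E → ℝ≥0∞} (hf : ∀ i, Measurable (f i)) {i j : ι} (hij : i ≠ j) :
    ∫⁻ z, f i (z i) * f j (z j) ∂(Measure.pi μ) =
      (∫⁻ e, f i e ∂(μ i)) * ∫⁻ e, f j e ∂(μ j) := by
  have h := (ProbabilityTheory.iIndepFun_pi (μ := μ) (X := f)
    fun i => (hf i).aemeasurable).indepFun hij
  have h2 := ProbabilityTheory.lintegral_mul_eq_lintegral_mul_lintegral_of_indepFun
    ((hf i).comp (measurable_pi_apply i)) ((hf j).comp (measurable_pi_apply j)) h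
  rw [← (measurePreserving_eval μ i).lintegral_comp (hf i),
    ← (measurePreserving_eval μ j).lintegral_comp (hf j)]
  exact h2

/-- The second moment of an average of independent variables. -/
theorem lintegral_avg_sq_pi_le {μ : ι → Measure E} [∀ i, IsProbabilityMeasure (μ i)]
    {f : ι → E → ℝ≥0∞} (hf : ∀ i, Measurable (f i)) {D : ℝ≥0∞}
    (hD : ∀ i, ∀ᵐ e ∂(μ i), f i e ≤ D) :
    ∫⁻ z, avg (fun i => f i (z i)) ^ 2 ∂(Measure.pi μ) ≤
      (avg fun i => ∫⁻ e, f i e ∂(μ i)) ^ 2 + D ^ 2 / Fintype.card ι := by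
  classical
  have hfm : ∀ i, Measurable fun z : ι → E => f i (z i) := fun i =>
    (hf i).comp (measurable_pi_apply i)
  set a : ι → ℝ≥0∞ := fun i => ∫⁻ e, f i e ∂(μ i) with ha
  -- Off the diagonal independence gives equality. On the diagonal `D ^ 2` alone suffices, and
  -- adding `a i * a i` completes the square of the mean.
  have hpair : ∀ i j, ∫⁻ z, f i (z i) * f j (z j) ∂(Measure.pi μ) ≤
      a i * a j + if i = j then D ^ 2 else 0 := by
    intro i j
    by_cases hij : i = j
    · subst hij
      rw [if_pos rfl]
      refine le_add_left ?_
      calc ∫⁻ z, f i (z i) * f i (z i) ∂(Measure.pi μ)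
          = ∫⁻ e, f i e * f i e ∂(μ i) :=
            (measurePreserving_eval μ i).lintegral_comp ((hf i).mul (hf i))
        _ ≤ ∫⁻ _e, D ^ 2 ∂(μ i) := by
            refine lintegral_mono_ae ?_
            filter_upwards [hD i] with e he
            rw [sq]; gcongr
        _ = D ^ 2 := by simp
    · rw [if_neg hij, add_zero, lintegral_mul_pi hf hij]
  have hexp : ∀ v : ι → ℝ≥0∞, avg v ^ 2 =
      (Fintype.card ι : ℝ≥0∞)⁻¹ ^ 2 * ∑ i, ∑ j, v i * v j := by
    intro v
    unfold avg
    rw [mul_pow, sq (∑ i, v i), Finset.sum_mul_sum]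
  simp only [hexp]
  rw [lintegral_const_mul _ (by fun_prop), lintegral_finsetSum _ (by fun_prop)]
  have hinner : ∀ i, ∫⁻ z, ∑ j, f i (z i) * f j (z j) ∂(Measure.pi μ) =
      ∑ j, ∫⁻ z, f i (z i) * f j (z j) ∂(Measure.pi μ) := fun i =>
    lintegral_finsetSum _ (by fun_prop)
  simp only [hinner]
  calc _ ≤ (Fintype.card ι : ℝ≥0∞)⁻¹ ^ 2 *
        ∑ i, ∑ j, (a i * a j + if i = j then D ^ 2 else 0) := by
        gcongr with i _ j _; exact hpair i j
    _ ≤ _ := by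
        simp only [Finset.sum_add_distrib, Finset.sum_ite_eq, Finset.mem_univ, if_true, mul_add,
          Finset.sum_const, Finset.card_univ, nsmul_eq_mul]
        gcongr
        -- With `n` indices the diagonal contributes `n⁻¹ ^ 2 * (n * D ^ 2)`; cancelling one factor
        -- `n` requires `n ≠ 0`.
        rcases isEmpty_or_nonempty ι with h | h
        · simp
        · rw [sq, div_eq_mul_inv, mul_assoc, ← mul_assoc _ (Fintype.card ι : ℝ≥0∞),
            ENNReal.inv_mul_cancel (by simp) (by simp), one_mul, mul_comm]

/-- The weighted resampling identity, which also holds when all weights vanish. -/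
theorem avg_mul_lintegral_resample (w : ι → ℝ) (x : ι → E) {ψ : E → ℝ≥0∞} (hψ : Measurable ψ) :
    (avg fun l => ENNReal.ofReal (w l)) * ∫⁻ e, ψ e ∂(resample w x) =
      avg fun l => ENNReal.ofReal (w l) * ψ (x l) := by
  unfold avg
  rw [mul_assoc]
  congr 1
  unfold resample
  split_ifs with h
  -- A zero sum forces every weight to be zero, so both sides vanish and the uniform default draw
  -- plays no role.
  · rw [h, zero_mul]
    symm
    rw [Finset.sum_eq_zero_iff] at h ⊢
    intro l hl
    rw [h l hl, zero_mul]
  · simp only [lintegral_finsetSum_measure, lintegral_smul_measure, lintegral_dirac' _ hψ,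
      smul_eq_mul]
    rw [Finset.mul_sum]
    refine Finset.sum_congr rfl fun l _ => ?_
    rw [← mul_assoc, ENNReal.mul_div_cancel h
      (ENNReal.sum_ne_top.2 fun _ _ => ENNReal.ofReal_ne_top)]

variable [Nonempty ι]

theorem avg_mul_lintegral_multinomial (w : ι → ℝ) (x : ι → E) {ψ : E → ℝ≥0∞}
    (hψ : Measurable ψ) :
    (avg fun l => ENNReal.ofReal (w l)) * ∫⁻ z, avg (fun l => ψ (z l)) ∂(multinomial w x) =
      avg fun l => ENNReal.ofReal (w l) * ψ (x l) := by
  rw [← avg_mul_lintegral_resample w x hψ]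
  congr 1
  unfold multinomial
  rw [lintegral_avg_pi (f := fun _ => ψ) fun _ => hψ]
  exact avg_const _

/-- The draws are independent with a common law, so only the diagonal is lost; the factor in front
turns the squared mean into the squared weighted average. -/
theorem avg_sq_mul_lintegral_multinomial_le (w : ι → ℝ) (x : ι → E) {ψ : E → ℝ≥0∞}
    (hψ : Measurable ψ) {B : ℝ≥0∞} (hB : ∀ e, ψ e ≤ B) :
    (avg fun l => ENNReal.ofReal (w l)) ^ 2 *
        ∫⁻ z, avg (fun l => ψ (z l)) ^ 2 ∂(multinomial w x) ≤
      (avg fun l => ENNReal.ofReal (w l) * ψ (x l)) ^ 2 +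
        (avg fun l => ENNReal.ofReal (w l)) ^ 2 * (B ^ 2 / Fintype.card ι) := by
  have h := lintegral_avg_sq_pi_le (μ := fun _ : ι => resample w x) (f := fun _ => ψ)
    (fun _ => hψ) (D := B) (fun _ => ae_of_all _ hB)
  rw [avg_const] at h
  rw [← avg_mul_lintegral_resample w x hψ, mul_pow, ← mul_add]
  gcongr
  exact h

end Moments

/-! ### Products of average weights, and the local filter of one island -/

theorem measurable_snoc {X β : Type*} [MeasurableSpace X] [MeasurableSpace β] {n : ℕ}
    {a : X → Fin n → β} {b : X → β} (ha : Measurable a) (hb : Measurable b) :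
    Measurable fun x => (Fin.snoc (α := fun _ => β) (a x) (b x) : Fin (n + 1) → β) := by
  refine measurable_pi_iff.2 fun i => ?_
  refine Fin.lastCases ?_ (fun i => ?_) i
  · simpa only [Fin.snoc_last] using hb
  · simp only [Fin.snoc_castSucc]
    fun_prop

/-- The product over the steps of the averages of the weights. -/
noncomputable def prodAvg {n : ℕ} {ι : Type*} [Fintype ι] (w : Fin n → ι → ℝ) : ℝ≥0∞ :=
  ∏ k, avg fun i => ENNReal.ofReal (w k i)

theorem prodAvg_snoc {n : ℕ} {ι : Type*} [Fintype ι] (w : Fin n → ι → ℝ) (v : ι → ℝ) :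
    prodAvg (Fin.snoc (α := fun _ => ι → ℝ) w v) =
      prodAvg w * avg fun i => ENNReal.ofReal (v i) := by
  simp [prodAvg, Fin.prod_univ_castSucc]

theorem measurable_prodAvg {n : ℕ} {ι : Type*} [Fintype ι] :
    Measurable (prodAvg : (Fin n → ι → ℝ) → ℝ≥0∞) :=
  Finset.measurable_prod _ fun k _ => measurable_avg fun i => by fun_prop

theorem prodAvg_le {n : ℕ} {ι : Type*} [Fintype ι] [Nonempty ι] {w : Fin n → ι → ℝ}
    {C : Fin n → ℝ} (h : ∀ k i, w k i ≤ C k) : prodAvg w ≤ ∏ k, ENNReal.ofReal (C k) :=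
  Finset.prod_le_prod' fun k _ => avg_le fun i => ENNReal.ofReal_le_ofReal (h k i)

namespace Model

variable {d dy : ℕ} (S : Model d dy)

theorem measurable_G {k j : ℕ} (hk : 1 ≤ k) (hj : j < d) :
    Measurable fun p : LocalParticle d (j + 1) => S.G k j p.1 p.2 := by
  refine (S.α_measurable k j hk hj).div ((S.q_measurable k j hk hj).comp
    (f := fun p : LocalParticle d (j + 1) =>
      ((p.1, fun i : Fin j => p.2 i.castSucc), p.2 (Fin.last j))) (by fun_prop))

theorem G_nonneg {k j : ℕ} (hk : 1 ≤ k) (hj : j < d) (x : Fin d → ℝ) (u : Fin (j + 1) → ℝ) :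
    0 ≤ S.G k j x u :=
  div_nonneg (S.α_nonneg k j hk hj x u) (S.q_nonneg k j hk hj _ _ _)

theorem isProbabilityMeasure_proposal {k j : ℕ} (hk : 1 ≤ k) (hj : j < d)
    (p : LocalParticle d j) : IsProbabilityMeasure (S.proposal k j p) :=
  ⟨by rw [proposal, withDensity_apply _ MeasurableSet.univ, Measure.restrict_univ,
    S.q_density k j hk hj p.1 p.2]⟩

theorem measurable_proposal {k j : ℕ} (hk : 1 ≤ k) (hj : j < d) :
    Measurable (S.proposal k j) := by
  refine Measure.measurable_of_measurable_coe _ fun s hs => ?_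
  simp only [proposal, withDensity_apply _ hs]
  exact Measurable.lintegral_prod_right' (S.q_measurable k j hk hj).ennreal_ofReal

theorem measurable_extend {X : Type*} [MeasurableSpace X] {j : ℕ} {p : X → LocalParticle d j}
    {t : X → ℝ} (hp : Measurable p) (ht : Measurable t) :
    Measurable fun x => extend (p x) (t x) :=
  (measurable_fst.comp hp).prodMk (measurable_snoc (measurable_snd.comp hp) ht)

section Local

variable {M : ℕ}

/-- The proposed particles of a space-step. -/
def proposed {j : ℕ} (s : LocalState d M j) (t : Fin M → ℝ) : Fin M → LocalParticle d (j + 1) :=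
  fun l => extend (s.2 l) (t l)

/-- The weights of the proposed particles of a space-step. -/
noncomputable def proposedWeight (k : ℕ) {j : ℕ} (s : LocalState d M j) (t : Fin M → ℝ) :
    Fin M → ℝ :=
  fun l => S.G k j (proposed s t l).1 (proposed s t l).2

theorem measurable_proposed {j : ℕ} :
    Measurable fun p : LocalState d M j × (Fin M → ℝ) => proposed p.1 p.2 :=
  measurable_pi_iff.2 fun l => measurable_extend (by fun_prop) (by fun_prop)

theorem measurable_proposedWeight {k j : ℕ} (hk : 1 ≤ k) (hj : j < d) :
    Measurable fun p : LocalState d M j × (Fin M → ℝ) => S.proposedWeight k p.1 p.2 :=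
  measurable_pi_iff.2 fun l =>
    (S.measurable_G hk hj).comp ((measurable_pi_apply l).comp measurable_proposed)

variable [Nonempty (Fin M)]

/-- Joint measurability in the state and the proposals makes the whole step a kernel; fixing the
state gives the measurability needed to integrate over one step. -/
theorem measurable_localStep_aux {k j : ℕ} (hk : 1 ≤ k) (hj : j < d) :
    Measurable fun p : LocalState d M j × (Fin M → ℝ) =>
      (multinomial (S.proposedWeight k p.1 p.2) (proposed p.1 p.2)).map
        (Prod.mk (Fin.snoc (α := fun _ => Fin M → ℝ) p.1.1 (S.proposedWeight k p.1 p.2) :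
          Fin (j + 1) → Fin M → ℝ)) :=
  measurable_map_multinomial (S.measurable_proposedWeight hk hj) measurable_proposed
    (measurable_snoc (by fun_prop) (S.measurable_proposedWeight hk hj))

theorem measurable_localStep {k j : ℕ} (hk : 1 ≤ k) (hj : j < d) :
    Measurable (S.localStep M k j) := by
  have := fun p => S.isProbabilityMeasure_proposal hk hj p
  have hpi : Measurable fun s : LocalState d M j =>
      Measure.pi fun l => S.proposal k j (s.2 l) :=
    measurable_pi_measure (fun l => (S.measurable_proposal hk hj).comp
      ((measurable_pi_apply l).comp measurable_snd)) fun _ _ => inferInstance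
  exact measurable_bind_of_prod hpi (fun _ => inferInstance) (S.measurable_localStep_aux hk hj)

theorem isProbabilityMeasure_localStep {k j : ℕ} (hk : 1 ≤ k) (hj : j < d)
    (s : LocalState d M j) : IsProbabilityMeasure (S.localStep M k j s) := by
  have := fun p => S.isProbabilityMeasure_proposal hk hj p
  exact isProbabilityMeasure_bind_of_forall
    ((S.measurable_localStep_aux hk hj).comp measurable_prodMk_left)
    fun t => Measure.isProbabilityMeasure_map measurable_prodMk_left.aemeasurable

theorem lintegral_localStep {k j : ℕ} (hk : 1 ≤ k) (hj : j < d) (s : LocalState d M j)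
    {F : LocalState d M (j + 1) → ℝ≥0∞} (hF : Measurable F) :
    ∫⁻ s', F s' ∂(S.localStep M k j s) =
      ∫⁻ t, ∫⁻ x', F (Fin.snoc (α := fun _ => Fin M → ℝ) s.1 (S.proposedWeight k s t), x')
        ∂(multinomial (S.proposedWeight k s t) (proposed s t))
        ∂(Measure.pi fun l => S.proposal k j (s.2 l)) := by
  have hm := (S.measurable_localStep_aux (M := M) hk hj).comp (measurable_prodMk_left (x := s))
  refine (Measure.lintegral_bind hm.aemeasurable hF.aemeasurable).trans ?_
  refine lintegral_congr fun t => ?_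
  exact lintegral_map hF measurable_prodMk_left

theorem isProbabilityMeasure_localLaw {k : ℕ} (hk : 1 ≤ k) (a : Fin M → Fin d → ℝ) {j : ℕ}
    (hj : j ≤ d) : IsProbabilityMeasure (S.localLaw M k a j) := by
  induction j with
  | zero => unfold localLaw; infer_instance
  | succ j ih =>
    have := ih (by omega)
    exact isProbabilityMeasure_bind_of_forall (S.measurable_localStep hk hj)
      (S.isProbabilityMeasure_localStep hk hj)

theorem measurable_localLaw {k : ℕ} (hk : 1 ≤ k) {j : ℕ} (hj : j ≤ d) :
    Measurable fun a => S.localLaw M k a j := by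
  induction j with
  | zero =>
    unfold localLaw
    exact Measure.measurable_dirac.comp (by fun_prop)
  | succ j ih =>
    exact (Measure.measurable_bind' (S.measurable_localStep hk hj)).comp (ih (by omega))

/-- In the local filter the ancestors stay in `A`, and the weights are nonnegative and bounded. -/
theorem ae_localLaw {k : ℕ} (hk : 1 ≤ k) {A : Set (Fin d → ℝ)} (hA : MeasurableSet A) {C : ℝ}
    (hC : ∀ j < d, ∀ x ∈ A, ∀ u, S.G k j x u ≤ C) {a : Fin M → Fin d → ℝ} (ha : ∀ l, a l ∈ A)
    {j : ℕ} (hj : j ≤ d) :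
    ∀ᵐ s ∂(S.localLaw M k a j),
      (∀ i l, 0 ≤ s.1 i l ∧ s.1 i l ≤ C) ∧ ∀ l, (s.2 l).1 ∈ A := by
  have hW : ∀ j, MeasurableSet {w : Fin j → Fin M → ℝ | ∀ i l, 0 ≤ w i l ∧ w i l ≤ C} := by
    intro j
    refine measurableSet_forall fun i => measurableSet_forall fun l => ?_
    have hil : Measurable fun w : Fin j → Fin M → ℝ => w i l := by fun_prop
    exact (measurableSet_le measurable_const hil).inter (measurableSet_le hil measurable_const)
  have hP : ∀ j, MeasurableSet {p : LocalParticle d j | p.1 ∈ A} := fun j =>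
    hA.preimage measurable_fst
  have hS : ∀ j, MeasurableSet {s : LocalState d M j |
      (∀ i l, 0 ≤ s.1 i l ∧ s.1 i l ≤ C) ∧ ∀ l, (s.2 l).1 ∈ A} := fun j =>
    ((hW j).preimage measurable_fst).inter (measurableSet_forall fun l =>
      (hP j).preimage ((measurable_pi_apply l).comp measurable_snd))
  induction j with
  | zero =>
    unfold localLaw
    rw [ae_dirac_iff (hS 0)]
    exact ⟨fun i => i.elim0, ha⟩
  | succ j ih =>
    refine ae_bind_of_ae (S.measurable_localStep hk hj) (hS _) ?_
    filter_upwards [ih (by omega)] with s hs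
    refine ae_bind_of_ae
      ((S.measurable_localStep_aux (M := M) hk hj).comp (measurable_prodMk_left (x := s)))
      (hS _) (ae_of_all _ fun t => ?_)
    -- `extend` leaves the ancestor unchanged, so the ancestor of each proposed particle is in `A`
    -- and the bound on `G` applies to the new weights.
    refine ae_map_multinomial (r := fun w : Fin (j + 1) → Fin M → ℝ =>
      ∀ i l, 0 ≤ w i l ∧ w i l ≤ C) (hP _) (hW _) (fun l => hs.2 l) fun i l => ?_
    refine Fin.lastCases ?_ (fun i => ?_) i
    · rw [Fin.snoc_last]
      exact ⟨S.G_nonneg hk hj _ _, hC j hj _ (hs.2 l) _⟩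
    · rw [Fin.snoc_castSucc]
      exact hs.1 i l

/-- The unnormalized transition of one space-step. -/
noncomputable def spaceOp (k j : ℕ) (ψ : LocalParticle d (j + 1) → ℝ≥0∞)
    (p : LocalParticle d j) : ℝ≥0∞ :=
  ∫⁻ t, ENNReal.ofReal (S.G k j (extend p t).1 (extend p t).2) * ψ (extend p t)
    ∂(S.proposal k j p)

/-- The unnormalized transition of the first `j` space-steps. -/
noncomputable def spaceOps (k : ℕ) : (j : ℕ) → (LocalParticle d j → ℝ≥0∞) →
    (Fin d → ℝ) → ℝ≥0∞
  | 0, ψ => fun x => ψ (x, Fin.elim0)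
  | j + 1, ψ => spaceOps k j (S.spaceOp k j ψ)

theorem measurable_spaceOp_integrand {k j : ℕ} (hk : 1 ≤ k) (hj : j < d)
    {ψ : LocalParticle d (j + 1) → ℝ≥0∞} (hψ : Measurable ψ) :
    Measurable fun p : LocalParticle d j × ℝ =>
      ENNReal.ofReal (S.G k j (extend p.1 p.2).1 (extend p.1 p.2).2) * ψ (extend p.1 p.2) := by
  have he : Measurable fun p : LocalParticle d j × ℝ => extend p.1 p.2 :=
    measurable_extend measurable_fst measurable_snd
  exact ((S.measurable_G hk hj).comp he).ennreal_ofReal.mul (hψ.comp he)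

theorem measurable_spaceOp {k j : ℕ} (hk : 1 ≤ k) (hj : j < d)
    {ψ : LocalParticle d (j + 1) → ℝ≥0∞} (hψ : Measurable ψ) :
    Measurable (S.spaceOp k j ψ) := by
  let κ : ProbabilityTheory.Kernel (LocalParticle d j) ℝ :=
    ⟨S.proposal k j, S.measurable_proposal hk hj⟩
  have : ProbabilityTheory.IsMarkovKernel κ := ⟨S.isProbabilityMeasure_proposal hk hj⟩
  exact Measurable.lintegral_kernel_prod_right' (κ := κ) (S.measurable_spaceOp_integrand hk hj hψ)

theorem measurable_spaceOps {k j : ℕ} (hk : 1 ≤ k) (hj : j ≤ d)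
    {ψ : LocalParticle d j → ℝ≥0∞} (hψ : Measurable ψ) :
    Measurable (S.spaceOps k j ψ) := by
  induction j with
  | zero => exact hψ.comp (by fun_prop)
  | succ j ih => exact ih (by omega) (S.measurable_spaceOp hk hj hψ)

/-- Unbiasedness of the weighted local filter. -/
theorem lintegral_localLaw {k j : ℕ} (hk : 1 ≤ k) (hj : j ≤ d) (a : Fin M → Fin d → ℝ)
    {ψ : LocalParticle d j → ℝ≥0∞} (hψ : Measurable ψ) :
    ∫⁻ s, prodAvg s.1 * avg (fun l => ψ (s.2 l)) ∂(S.localLaw M k a j) =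
      avg fun l => S.spaceOps k j ψ (a l) := by
  have hmeas : ∀ {j} {ψ : LocalParticle d j → ℝ≥0∞}, Measurable ψ →
      Measurable fun s : LocalState d M j => prodAvg s.1 * avg (fun l => ψ (s.2 l)) := by
    intro j ψ hψ
    exact (measurable_prodAvg.comp measurable_fst).mul
      (measurable_avg fun l => hψ.comp (by fun_prop))
  induction j with
  | zero =>
    unfold localLaw
    rw [lintegral_dirac' _ (hmeas hψ)]
    simp [prodAvg, spaceOps]
  | succ j ih =>
    have hp := fun p => S.isProbabilityMeasure_proposal (k := k) hk hj p
    refine (Measure.lintegral_bind (S.measurable_localStep hk hj).aemeasurable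
      (hmeas hψ).aemeasurable).trans ?_
    -- The recursion runs backwards: the last space-step is absorbed into the test function, and the
    -- induction hypothesis is used for `spaceOp k j ψ`.
    refine Eq.trans (lintegral_congr fun s => ?_)
      (ih (by omega) (S.measurable_spaceOp hk hj hψ))
    rw [S.lintegral_localStep hk hj s (hmeas hψ)]
    simp only [prodAvg_snoc]
    have hmψ : Measurable fun x : Fin M → LocalParticle d (j + 1) => avg fun l => ψ (x l) :=
      measurable_avg fun l => hψ.comp (by fun_prop)
    -- Given the proposals, the new average weight cancels the normalization of the resampling;
    -- integrating over the proposals then produces `spaceOp`.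
    have hinner : ∀ t : Fin M → ℝ,
        ∫⁻ x', (prodAvg s.1 * avg fun l => ENNReal.ofReal (S.proposedWeight k s t l)) *
          avg (fun l => ψ (x' l)) ∂(multinomial (S.proposedWeight k s t) (proposed s t)) =
        prodAvg s.1 * avg fun l => ENNReal.ofReal (S.proposedWeight k s t l) *
          ψ (proposed s t l) := by
      intro t
      rw [lintegral_const_mul _ hmψ, mul_assoc, avg_mul_lintegral_multinomial _ _ hψ]
    simp only [hinner]
    have hf : ∀ l : Fin M, Measurable fun t : ℝ =>
        ENNReal.ofReal (S.G k j (extend (s.2 l) t).1 (extend (s.2 l) t).2) *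
          ψ (extend (s.2 l) t) := fun l =>
      (S.measurable_spaceOp_integrand hk hj hψ).comp measurable_prodMk_left
    rw [lintegral_const_mul]
    · congr 1
      exact lintegral_avg_pi hf
    · exact measurable_avg fun l => (hf l).comp (measurable_pi_apply l)

end Local

end Model

/-! ### Real and extended averages, and the unnormalized estimate -/

theorem ofReal_average {n : ℕ} {v : Fin n → ℝ} (hv : ∀ i, 0 ≤ v i) :
    ENNReal.ofReal ((1 / (n : ℝ)) * ∑ i, v i) = avg fun i => ENNReal.ofReal (v i) := by
  rcases Nat.eq_zero_or_pos n with rfl | hn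
  · simp [avg]
  · have hn' : (0 : ℝ) < n := by exact_mod_cast hn
    rw [avg, ENNReal.ofReal_mul (by positivity), ENNReal.ofReal_sum_of_nonneg fun i _ => hv i,
      one_div, ENNReal.ofReal_inv_of_pos hn', ENNReal.ofReal_natCast, Fintype.card_fin]

theorem average_nonneg {n : ℕ} {v : Fin n → ℝ} (hv : ∀ i, 0 ≤ v i) :
    0 ≤ (1 / (n : ℝ)) * ∑ i, v i :=
  mul_nonneg (by positivity) (Finset.sum_nonneg fun i _ => hv i)

theorem average_le {n : ℕ} (hn : 0 < n) {v : Fin n → ℝ} {C : ℝ} (hv : ∀ i, v i ≤ C) :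
    (1 / (n : ℝ)) * ∑ i, v i ≤ C := by
  have hn' : (0 : ℝ) < n := by exact_mod_cast hn
  have h : ∑ i, v i ≤ n * C := by
    calc ∑ i, v i ≤ ∑ _i : Fin n, C := Finset.sum_le_sum fun i _ => hv i
      _ = n * C := by simp
  rw [one_div, inv_mul_le_iff₀ hn']
  exact h

theorem ofReal_prod_average {m n : ℕ} {w : Fin m → Fin n → ℝ} (hw : ∀ j l, 0 ≤ w j l) :
    ENNReal.ofReal (∏ j, (1 / (n : ℝ)) * ∑ l, w j l) = prodAvg w := by
  rw [prodAvg, ENNReal.ofReal_prod_of_nonneg fun j _ => average_nonneg (hw j)]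
  exact Finset.prod_congr rfl fun j _ => ofReal_average (hw j)

theorem globalWeight_nonneg {d M : ℕ} {w : Fin d → Fin M → ℝ} (hw : ∀ j l, 0 ≤ w j l) :
    0 ≤ globalWeight w :=
  Finset.prod_nonneg fun j _ => average_nonneg (hw j)

theorem globalWeight_le {d M : ℕ} (hM : 0 < M) {w : Fin d → Fin M → ℝ} {C : ℝ}
    (hw : ∀ j l, 0 ≤ w j l ∧ w j l ≤ C) : globalWeight w ≤ C ^ d := by
  calc globalWeight w ≤ ∏ _j : Fin d, C :=
        Finset.prod_le_prod (fun j _ => average_nonneg fun l => (hw j l).1)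
          fun j _ => average_le hM fun l => (hw j l).2
    _ = C ^ d := by simp

theorem measurable_globalWeight {d M : ℕ} :
    Measurable (globalWeight : (Fin d → Fin M → ℝ) → ℝ) := by
  unfold globalWeight
  fun_prop

/-- The average of `ψ` over all particles of all islands. -/
noncomputable def particleAvg {d M N : ℕ} (ψ : (Fin d → ℝ) → ℝ≥0∞)
    (x : Fin N → Fin M → Fin d → ℝ) : ℝ≥0∞ :=
  avg fun i => avg fun l => ψ (x i l)

theorem measurable_islandAvg {d M : ℕ} {ψ : (Fin d → ℝ) → ℝ≥0∞} (hψ : Measurable ψ) :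
    Measurable fun x : Fin M → Fin d → ℝ => avg fun l => ψ (x l) :=
  measurable_avg fun l => hψ.comp (measurable_pi_apply l)

theorem measurable_particleAvg {d M N : ℕ} {ψ : (Fin d → ℝ) → ℝ≥0∞} (hψ : Measurable ψ) :
    Measurable (particleAvg ψ : (Fin N → Fin M → Fin d → ℝ) → ℝ≥0∞) :=
  measurable_avg fun i => (measurable_islandAvg hψ).comp (measurable_pi_apply i)

/-- The unnormalized estimate of the integral of `ψ`. -/
noncomputable def unnormEstimate {d M N n : ℕ} (ψ : (Fin d → ℝ) → ℝ≥0∞)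
    (s : GlobalState d M N n) : ℝ≥0∞ :=
  prodAvg s.1 * particleAvg ψ s.2

theorem measurable_unnormEstimate {d M N n : ℕ} {ψ : (Fin d → ℝ) → ℝ≥0∞} (hψ : Measurable ψ) :
    Measurable (unnormEstimate ψ : GlobalState d M N n → ℝ≥0∞) :=
  (measurable_prodAvg.comp measurable_fst).mul
    ((measurable_particleAvg hψ).comp measurable_snd)

/-! ### The global step as a Markov kernel -/

namespace Model

variable {d dy : ℕ} (S : Model d dy) {M N : ℕ}

/-- The global weights of the islands. -/
noncomputable def islandWeight (z : Fin N → LocalState d M d) : Fin N → ℝ :=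
  fun i => globalWeight (z i).1

/-- The current states of the particles of the islands. -/
def islandState (z : Fin N → LocalState d M d) : Fin N → Fin M → Fin d → ℝ :=
  fun i l => ((z i).2 l).2

theorem measurable_islandWeight :
    Measurable (islandWeight : (Fin N → LocalState d M d) → Fin N → ℝ) :=
  measurable_pi_iff.2 fun _ => measurable_globalWeight.comp (by fun_prop)

theorem measurable_islandState :
    Measurable (islandState : (Fin N → LocalState d M d) → Fin N → Fin M → Fin d → ℝ) := by
  unfold islandState
  fun_prop

/-- The unnormalized transition of one time-step. -/
noncomputable def timeOp (k : ℕ) (ψ : (Fin d → ℝ) → ℝ≥0∞) : (Fin d → ℝ) → ℝ≥0∞ :=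
  S.spaceOps k d fun p => ψ p.2

theorem measurable_timeOp {k : ℕ} (hk : 1 ≤ k) {ψ : (Fin d → ℝ) → ℝ≥0∞} (hψ : Measurable ψ) :
    Measurable (S.timeOp k ψ) :=
  S.measurable_spaceOps hk le_rfl (hψ.comp measurable_snd)

variable [Nonempty (Fin N)]

theorem measurable_globalStep_aux (n : ℕ) :
    Measurable fun p : GlobalState d M N n × (Fin N → LocalState d M d) =>
      (multinomial (islandWeight p.2) (islandState p.2)).map
        (Prod.mk (Fin.snoc (α := fun _ => Fin N → ℝ) p.1.1 (islandWeight p.2) :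
          Fin (n + 1) → Fin N → ℝ)) :=
  measurable_map_multinomial (measurable_islandWeight.comp measurable_snd)
    (measurable_islandState.comp measurable_snd)
    (measurable_snoc (by fun_prop) (measurable_islandWeight.comp measurable_snd))

theorem lintegral_globalStep (n : ℕ) (s : GlobalState d M N n)
    {F : GlobalState d M N (n + 1) → ℝ≥0∞} (hF : Measurable F) :
    ∫⁻ s', F s' ∂(S.globalStep M N n s) =
      ∫⁻ z, ∫⁻ x', F (Fin.snoc (α := fun _ => Fin N → ℝ) s.1 (islandWeight z), x')
        ∂(multinomial (islandWeight z) (islandState z))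
        ∂(Measure.pi fun i => S.localLaw M (n + 1) (s.2 i) d) := by
  have hm := (measurable_globalStep_aux (d := d) (M := M) (N := N) n).comp
    (measurable_prodMk_left (x := s))
  refine (Measure.lintegral_bind hm.aemeasurable hF.aemeasurable).trans ?_
  refine lintegral_congr fun t => ?_
  exact lintegral_map hF measurable_prodMk_left

variable [Nonempty (Fin M)]

theorem measurable_globalStep (n : ℕ) : Measurable (S.globalStep M N n) := by
  have := fun a : Fin M → Fin d → ℝ =>
    S.isProbabilityMeasure_localLaw (k := n + 1) (by omega) a le_rfl
  have hpi : Measurable fun s : GlobalState d M N n =>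
      Measure.pi fun i => S.localLaw M (n + 1) (s.2 i) d :=
    measurable_pi_measure (fun i => (S.measurable_localLaw (by omega) le_rfl).comp
      ((measurable_pi_apply i).comp measurable_snd)) fun _ _ => inferInstance
  exact measurable_bind_of_prod hpi (fun _ => inferInstance) (measurable_globalStep_aux n)

theorem isProbabilityMeasure_globalStep (n : ℕ) (s : GlobalState d M N n) :
    IsProbabilityMeasure (S.globalStep M N n s) := by
  have := fun a : Fin M → Fin d → ℝ =>
    S.isProbabilityMeasure_localLaw (k := n + 1) (by omega) a le_rfl
  have hm := (measurable_globalStep_aux (d := d) (M := M) (N := N) n).comp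
    (measurable_prodMk_left (x := s))
  exact isProbabilityMeasure_bind_of_forall hm fun t =>
    Measure.isProbabilityMeasure_map measurable_prodMk_left.aemeasurable

theorem isProbabilityMeasure_law (n : ℕ) : IsProbabilityMeasure (S.law M N n) := by
  induction n with
  | zero => unfold law; infer_instance
  | succ n ih =>
    exact isProbabilityMeasure_bind_of_forall (S.measurable_globalStep n)
      (S.isProbabilityMeasure_globalStep n)

end Model

/-! ### Bounds and moments of the unnormalized estimates -/

namespace Model

variable {d dy : ℕ} (S : Model d dy) {M N : ℕ}

/-- The possible values of the state that precedes time `k`. -/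
def ancestorSet (k : ℕ) : Set (Fin d → ℝ) := {x | k = 1 → x = S.x0}

theorem measurableSet_ancestorSet (k : ℕ) : MeasurableSet (S.ancestorSet k) := by
  by_cases hk : k = 1
  · have : S.ancestorSet k = {S.x0} := by ext; simp [ancestorSet, hk]
    rw [this]; exact measurableSet_singleton _
  · have : S.ancestorSet k = Set.univ := by ext; simp [ancestorSet, hk]
    rw [this]; exact MeasurableSet.univ

theorem mem_ancestorSet_add_two (n : ℕ) (x : Fin d → ℝ) : x ∈ S.ancestorSet (n + 1 + 1) :=
  fun h => by omega

/-- The weights at time `k` are bounded by `C k`. -/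
def WeightBound (C : ℕ → ℝ) : Prop :=
  ∀ k, 1 ≤ k → ∀ j < d, ∀ x ∈ S.ancestorSet k, ∀ u, S.G k j x u ≤ C k

/-- The unnormalized transition of the first `n` time-steps, started at `x0`. -/
noncomputable def timeOps : ℕ → ((Fin d → ℝ) → ℝ≥0∞) → ℝ≥0∞
  | 0, ψ => ψ S.x0
  | n + 1, ψ => timeOps n (S.timeOp (n + 1) ψ)

variable {S} {C : ℕ → ℝ}

/-- Proposals are probabilities, so each space-step costs one factor `C k`. The ancestor is never
changed, hence bounds on `ancestorSet k` are enough; at time `1` nothing more is available. -/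
theorem spaceOps_le (hC : S.WeightBound C) {k : ℕ} (hk : 1 ≤ k) {j : ℕ} (hj : j ≤ d)
    {ψ : LocalParticle d j → ℝ≥0∞} {B : ℝ≥0∞} (hB : ∀ p, p.1 ∈ S.ancestorSet k → ψ p ≤ B)
    {x : Fin d → ℝ} (hx : x ∈ S.ancestorSet k) :
    S.spaceOps k j ψ x ≤ ENNReal.ofReal (C k) ^ j * B := by
  induction j generalizing B with
  | zero => simpa [spaceOps] using hB _ hx
  | succ j ih =>
    rw [pow_succ, mul_assoc]
    refine ih (by omega) fun p hp => ?_
    have := S.isProbabilityMeasure_proposal (k := k) hk hj p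
    calc S.spaceOp k j ψ p ≤ ∫⁻ _t, ENNReal.ofReal (C k) * B ∂(S.proposal k j p) := by
          refine lintegral_mono fun t => ?_
          dsimp only
          gcongr
          · exact hC k hk j hj _ hp _
          · exact hB _ hp
      _ = ENNReal.ofReal (C k) * B := by simp

theorem timeOp_le (hC : S.WeightBound C) {k : ℕ} (hk : 1 ≤ k) {ψ : (Fin d → ℝ) → ℝ≥0∞}
    {B : ℝ≥0∞} (hB : ∀ x, ψ x ≤ B) {x : Fin d → ℝ} (hx : x ∈ S.ancestorSet k) :
    S.timeOp k ψ x ≤ ENNReal.ofReal (C k) ^ d * B :=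
  spaceOps_le hC hk le_rfl (fun p _ => hB p.2) hx

theorem measurable_weighted_island {ψ : (Fin d → ℝ) → ℝ≥0∞} (hψ : Measurable ψ) :
    Measurable fun s : LocalState d M d => prodAvg s.1 * avg fun l => ψ (s.2 l).2 :=
  (measurable_prodAvg.comp measurable_fst).mul (measurable_avg fun l => hψ.comp (by fun_prop))

theorem avg_islandWeight_mul {z : Fin N → LocalState d M d} (hz : ∀ i j l, 0 ≤ (z i).1 j l)
    (ψ : (Fin d → ℝ) → ℝ≥0∞) :
    (avg fun i => ENNReal.ofReal (islandWeight z i) * avg fun l => ψ (islandState z i l)) =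
      avg fun i => prodAvg (z i).1 * avg fun l => ψ ((z i).2 l).2 := by
  unfold islandWeight islandState globalWeight
  simp only [ofReal_prod_average (hz _)]

variable [Nonempty (Fin M)]

theorem ae_islands (hC : S.WeightBound C) {n : ℕ} {a : Fin N → Fin M → Fin d → ℝ}
    (ha : ∀ i l, a i l ∈ S.ancestorSet (n + 1)) :
    ∀ᵐ z ∂(Measure.pi fun i => S.localLaw M (n + 1) (a i) d),
      ∀ i j l, 0 ≤ (z i).1 j l ∧ (z i).1 j l ≤ C (n + 1) := by
  have := fun a : Fin M → Fin d → ℝ =>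
    S.isProbabilityMeasure_localLaw (k := n + 1) (by omega) a le_rfl
  refine ae_pi_forall (p := fun _ (s : LocalState d M d) =>
    ∀ j l, 0 ≤ s.1 j l ∧ s.1 j l ≤ C (n + 1)) fun i => ?_
  filter_upwards [S.ae_localLaw (by omega) (S.measurableSet_ancestorSet (n + 1))
    (hC (n + 1) (by omega)) (ha i) le_rfl] with s hs using hs.1

variable [Nonempty (Fin N)]

/-- The global weights are nonnegative and bounded, and at time `0` all particles are at `x0`. -/
theorem ae_law (hC : S.WeightBound C) (n : ℕ) :
    ∀ᵐ s ∂(S.law M N n), (∀ (k : Fin n) i, 0 ≤ s.1 k i ∧ s.1 k i ≤ C (k + 1) ^ d) ∧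
      ∀ i l, s.2 i l ∈ S.ancestorSet (n + 1) := by
  have hW : ∀ n : ℕ, MeasurableSet {w : Fin n → Fin N → ℝ |
      ∀ k i, 0 ≤ w k i ∧ w k i ≤ C (k + 1) ^ d} := by
    intro n
    refine measurableSet_forall fun k => measurableSet_forall fun i => ?_
    have hki : Measurable fun w : Fin n → Fin N → ℝ => w k i := by fun_prop
    exact (measurableSet_le measurable_const hki).inter (measurableSet_le hki measurable_const)
  have hP : ∀ n : ℕ, MeasurableSet {x : Fin M → Fin d → ℝ |
      ∀ l, x l ∈ S.ancestorSet (n + 1)} := fun n =>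
    measurableSet_forall fun l =>
      (S.measurableSet_ancestorSet (n + 1)).preimage (measurable_pi_apply l)
  have hS : ∀ n : ℕ, MeasurableSet {s : GlobalState d M N n |
      (∀ (k : Fin n) i, 0 ≤ s.1 k i ∧ s.1 k i ≤ C (k + 1) ^ d) ∧
        ∀ i l, s.2 i l ∈ S.ancestorSet (n + 1)} := fun n =>
    ((hW n).preimage measurable_fst).inter (measurableSet_forall fun i =>
      (hP n).preimage ((measurable_pi_apply i).comp measurable_snd))
  induction n with
  | zero =>
    unfold law
    rw [ae_dirac_iff (hS 0)]
    -- Membership in `ancestorSet 1` means being equal to `x0`, where all particles start; from the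
    -- next time on the set is the whole space.
    exact ⟨fun k => k.elim0, fun _ _ _ => rfl⟩
  | succ n ih =>
    refine ae_bind_of_ae (S.measurable_globalStep n) (hS _) ?_
    filter_upwards [ih] with s hs
    have hm := (measurable_globalStep_aux (d := d) (M := M) (N := N) n).comp
      (measurable_prodMk_left (x := s))
    refine ae_bind_of_ae hm (hS _) ?_
    filter_upwards [ae_islands hC hs.2] with z hz
    refine ae_map_multinomial (r := fun w : Fin (n + 1) → Fin N → ℝ =>
      ∀ k i, 0 ≤ w k i ∧ w k i ≤ C (k + 1) ^ d) (p := fun x : Fin M → Fin d → ℝ =>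
      ∀ l, x l ∈ S.ancestorSet (n + 1 + 1)) (hP _) (hW _)
      (fun i l => S.mem_ancestorSet_add_two n _) fun k i => ?_
    refine Fin.lastCases ?_ (fun k => ?_) k
    · rw [Fin.snoc_last, Fin.val_last]
      exact ⟨globalWeight_nonneg fun j l => (hz i j l).1,
        globalWeight_le (Fin.pos_iff_nonempty.2 inferInstance) (hz i)⟩
    · rw [Fin.snoc_castSucc]
      exact hs.1 k i

theorem lintegral_weighted_island {k : ℕ} (hk : 1 ≤ k) (a : Fin M → Fin d → ℝ)
    {ψ : (Fin d → ℝ) → ℝ≥0∞} (hψ : Measurable ψ) :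
    ∫⁻ s, prodAvg s.1 * avg (fun l => ψ (s.2 l).2) ∂(S.localLaw M k a d) =
      avg fun l => S.timeOp k ψ (a l) :=
  S.lintegral_localLaw hk le_rfl a (hψ.comp measurable_snd)

/-- One time-step is unbiased for the unnormalized estimates. -/
theorem lintegral_globalStep_unnormEstimate (hC : S.WeightBound C) {n : ℕ}
    {s : GlobalState d M N n} (hs : ∀ i l, s.2 i l ∈ S.ancestorSet (n + 1))
    {ψ : (Fin d → ℝ) → ℝ≥0∞} (hψ : Measurable ψ) :
    ∫⁻ s', unnormEstimate ψ s' ∂(S.globalStep M N n s) =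
      unnormEstimate (S.timeOp (n + 1) ψ) s := by
  have := fun a : Fin M → Fin d → ℝ =>
    S.isProbabilityMeasure_localLaw (k := n + 1) (by omega) a le_rfl
  rw [S.lintegral_globalStep n s (measurable_unnormEstimate hψ)]
  have hX := measurable_weighted_island (M := M) (ψ := ψ) hψ
  have hXm : Measurable fun z : Fin N → LocalState d M d =>
      avg fun i => prodAvg (z i).1 * avg fun l => ψ ((z i).2 l).2 :=
    measurable_avg fun i => hX.comp (measurable_pi_apply i)
  calc _ = ∫⁻ z, prodAvg s.1 * avg (fun i => prodAvg (z i).1 * avg fun l => ψ ((z i).2 l).2)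
        ∂(Measure.pi fun i => S.localLaw M (n + 1) (s.2 i) d) := by
        refine lintegral_congr_ae ?_
        filter_upwards [ae_islands hC hs] with z hz
        simp only [unnormEstimate, prodAvg_snoc]
        rw [lintegral_const_mul _ (measurable_particleAvg hψ), mul_assoc]
        unfold particleAvg
        rw [avg_mul_lintegral_multinomial _ _ (measurable_islandAvg hψ),
          avg_islandWeight_mul fun i j l => (hz i j l).1]
    _ = _ := by
        rw [lintegral_const_mul _ hXm,
          lintegral_avg_pi (f := fun _ (s : LocalState d M d) =>
            prodAvg s.1 * avg fun l => ψ (s.2 l).2) fun _ => hX]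
        simp only [lintegral_weighted_island (Nat.le_add_left 1 n) _ hψ]
        rfl

/-- The second moment of the unnormalized estimates after one time-step. -/
theorem lintegral_globalStep_unnormEstimate_sq_le (hC : S.WeightBound C) {n : ℕ}
    {s : GlobalState d M N n} (hs : ∀ i l, s.2 i l ∈ S.ancestorSet (n + 1))
    {ψ : (Fin d → ℝ) → ℝ≥0∞} (hψ : Measurable ψ) {B : ℝ≥0∞} (hB : ∀ x, ψ x ≤ B) :
    ∫⁻ s', unnormEstimate ψ s' ^ 2 ∂(S.globalStep M N n s) ≤
      unnormEstimate (S.timeOp (n + 1) ψ) s ^ 2 +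
        prodAvg s.1 ^ 2 * (2 * (ENNReal.ofReal (C (n + 1)) ^ d * B) ^ 2 / N) := by
  have := fun a : Fin M → Fin d → ℝ =>
    S.isProbabilityMeasure_localLaw (k := n + 1) (by omega) a le_rfl
  rw [S.lintegral_globalStep n s ((measurable_unnormEstimate hψ).pow_const 2)]
  have hX := measurable_weighted_island (M := M) (ψ := ψ) hψ
  have hXm : Measurable fun z : Fin N → LocalState d M d =>
      avg fun i => prodAvg (z i).1 * avg fun l => ψ ((z i).2 l).2 :=
    measurable_avg fun i => hX.comp (measurable_pi_apply i)
  set D := ENNReal.ofReal (C (n + 1)) ^ d with hD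
  have hprod : ∀ w : Fin d → Fin M → ℝ, (∀ j l, w j l ≤ C (n + 1)) → prodAvg w ≤ D := by
    intro w hw
    simpa using prodAvg_le (C := fun _ => C (n + 1)) hw
  -- First source of variance: the islands, independent given `s`, with weighted averages bounded by
  -- `D * B`.
  have hsq := lintegral_avg_sq_pi_le (μ := fun i => S.localLaw M (n + 1) (s.2 i) d)
    (f := fun _ (s : LocalState d M d) => prodAvg s.1 * avg fun l => ψ (s.2 l).2)
    (fun _ => hX) (D := D * B) fun i => by
      filter_upwards [S.ae_localLaw (by omega) (S.measurableSet_ancestorSet (n + 1))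
        (hC (n + 1) (by omega)) (hs i) le_rfl] with z hz
      gcongr
      · exact hprod _ fun j l => (hz.1 j l).2
      · exact avg_le fun l => hB _
  simp only [lintegral_weighted_island (Nat.le_add_left 1 n) _ hψ, Fintype.card_fin] at hsq
  calc _ ≤ ∫⁻ z, prodAvg s.1 ^ 2 *
          (avg (fun i => prodAvg (z i).1 * avg fun l => ψ ((z i).2 l).2) ^ 2 +
            (D * B) ^ 2 / N)
        ∂(Measure.pi fun i => S.localLaw M (n + 1) (s.2 i) d) := by
        refine lintegral_mono_ae ?_
        filter_upwards [ae_islands hC hs] with z hz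
        simp only [unnormEstimate, prodAvg_snoc, mul_pow]
        rw [lintegral_const_mul _ ((measurable_particleAvg hψ).pow_const 2), mul_assoc]
        gcongr
        unfold particleAvg
        -- Second source: the global resampling, conditionally on the islands. Its excess is the
        -- squared average island weight, at most `D ^ 2`, times `B ^ 2 / N`.
        refine (avg_sq_mul_lintegral_multinomial_le _ _ (measurable_islandAvg hψ)
          (B := B) fun x => avg_le fun l => hB (x l)).trans ?_
        rw [avg_islandWeight_mul fun i j l => (hz i j l).1, Fintype.card_fin, ← mul_div_assoc]
        gcongr
        refine avg_le fun i => ?_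
        unfold islandWeight globalWeight
        rw [ofReal_prod_average fun j l => (hz i j l).1]
        exact hprod _ fun j l => (hz i j l).2
    _ ≤ _ := by
        rw [lintegral_const_mul _ ((hXm.pow_const 2).add_const _),
          lintegral_add_right _ measurable_const, lintegral_const, measure_univ, mul_one,
          unnormEstimate, mul_pow (prodAvg s.1), ← mul_add]
        refine mul_le_mul_right ((add_le_add_left hsq _).trans_eq ?_) _
        rw [add_assoc, two_mul, ENNReal.add_div]
        rfl

theorem unnormEstimate_init (ψ : (Fin d → ℝ) → ℝ≥0∞) :
    unnormEstimate ψ ((Fin.elim0, fun _ _ => S.x0) : GlobalState d M N 0) = ψ S.x0 := by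
  simp [unnormEstimate, prodAvg, particleAvg, avg_const]

/-- Unbiasedness of the unnormalized estimates. -/
theorem lintegral_law_unnormEstimate (hC : S.WeightBound C) (n : ℕ) {ψ : (Fin d → ℝ) → ℝ≥0∞}
    (hψ : Measurable ψ) :
    ∫⁻ s, unnormEstimate ψ s ∂(S.law M N n) = S.timeOps n ψ := by
  induction n generalizing ψ with
  | zero =>
    unfold law
    rw [lintegral_dirac' _ (measurable_unnormEstimate hψ), unnormEstimate_init, timeOps]
  | succ n ih =>
    refine (Measure.lintegral_bind (S.measurable_globalStep n).aemeasurable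
      (measurable_unnormEstimate hψ).aemeasurable).trans ?_
    rw [timeOps, ← ih (S.measurable_timeOp (by omega) hψ)]
    refine lintegral_congr_ae ?_
    filter_upwards [ae_law hC n] with s hs
    exact lintegral_globalStep_unnormEstimate hC hs.2 hψ

variable (M) in
/-- The variance of the unnormalized estimates is `O(1/N)`. -/
theorem lintegral_law_unnormEstimate_sq_le (hC : S.WeightBound C) (n : ℕ)
    {ψ : (Fin d → ℝ) → ℝ≥0∞} (hψ : Measurable ψ) {B : ℝ≥0∞} (hB' : B ≠ ∞)
    (hB : ∀ x ∈ S.ancestorSet (n + 1), ψ x ≤ B) :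
    ∃ K : ℝ≥0∞, K ≠ ∞ ∧ ∀ N : ℕ, Nonempty (Fin N) →
      ∫⁻ s, unnormEstimate ψ s ^ 2 ∂(S.law M N n) ≤ S.timeOps n ψ ^ 2 + K / N := by
  induction n generalizing ψ B with
  | zero =>
    -- At time `0` the estimate is deterministic, so there is no excess.
    refine ⟨0, by simp, fun N hN => ?_⟩
    unfold law
    rw [lintegral_dirac' _ ((measurable_unnormEstimate hψ).pow_const 2), unnormEstimate_init,
      timeOps]
    exact le_self_add
  | succ n ih =>
    have hB1 : ∀ x, ψ x ≤ B := fun x => hB x (S.mem_ancestorSet_add_two n x)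
    set D := ENNReal.ofReal (C (n + 1)) ^ d * B with hD
    have hDtop : D ≠ ∞ := ENNReal.mul_ne_top (by simp) hB'
    -- `timeOp` is only bounded on the possible ancestors, which is why the bound on the test
    -- function is assumed on `ancestorSet (n + 1)` alone.
    obtain ⟨K, hK, h⟩ := ih (S.measurable_timeOp (by omega) hψ) hDtop
      fun x hx => timeOp_le hC (by omega) hB1 hx
    set P := ∏ k : Fin n, ENNReal.ofReal (C (k + 1) ^ d) with hP
    have hPtop : P ≠ ∞ := ENNReal.prod_ne_top fun _ _ => ENNReal.ofReal_ne_top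
    -- `K` is inherited from the first `n` steps; the new term is the one-step excess, with `P`
    -- bounding the product of earlier average weights uniformly in `N`.
    refine ⟨K + P ^ 2 * (2 * D ^ 2), by finiteness, fun N hN => ?_⟩
    have := S.isProbabilityMeasure_law (M := M) (N := N) n
    calc _ = ∫⁻ s, ∫⁻ s', unnormEstimate ψ s' ^ 2 ∂(S.globalStep M N n s) ∂(S.law M N n) :=
          Measure.lintegral_bind (S.measurable_globalStep n).aemeasurable
            ((measurable_unnormEstimate hψ).pow_const 2).aemeasurable
      _ ≤ ∫⁻ s, (unnormEstimate (S.timeOp (n + 1) ψ) s ^ 2 + P ^ 2 * (2 * D ^ 2 / N))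
            ∂(S.law M N n) := by
          refine lintegral_mono_ae ?_
          filter_upwards [ae_law hC n] with s hs
          refine (lintegral_globalStep_unnormEstimate_sq_le hC hs.2 hψ hB1).trans ?_
          gcongr
          exact prodAvg_le (C := fun k : Fin n => C (k + 1) ^ d) fun k i => (hs.1 k i).2
      _ ≤ _ := by
          rw [lintegral_add_right _ measurable_const, lintegral_const, measure_univ, mul_one,
            timeOps, ENNReal.add_div, ← add_assoc, mul_div_assoc (P ^ 2)]
          gcongr
          exact h N hN

end Model

/-! ### Identification of the mean with the exact integral -/

/-- Tonelli with the last variable innermost. It serves both the coordinates (`E = ℝ`) and the times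
(`E = Fin d → ℝ`). -/
theorem lintegral_pi_snoc {E : Type*} [MeasureSpace E] [SigmaFinite (volume : Measure E)] {n : ℕ}
    {F : (Fin (n + 1) → E) → ℝ≥0∞} (hF : Measurable F) :
    ∫⁻ v, F v = ∫⁻ u : Fin n → E, ∫⁻ t : E, F (Fin.snoc (α := fun _ => E) u t) := by
  have h := (volume_preserving_piFinSuccAbove (fun _ : Fin (n + 1) => E) (Fin.last n)).symm
  rw [← h.lintegral_comp hF]
  have hm : Measurable fun p : E × (Fin n → E) =>
      F ((MeasurableEquiv.piFinSuccAbove (fun _ : Fin (n + 1) => E) (Fin.last n)).symm p) :=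
    hF.comp (MeasurableEquiv.measurable _)
  refine (lintegral_prod_symm' _ hm).trans ?_
  refine lintegral_congr fun u => lintegral_congr fun t => ?_
  congr 1
  exact Fin.insertNth_last' t u

namespace Model

variable {d dy : ℕ} (S : Model d dy)

theorem spaceOp_eq {k j : ℕ} (hk : 1 ≤ k) (hj : j < d) {ψ : LocalParticle d (j + 1) → ℝ≥0∞}
    (hψ : Measurable ψ) {x : Fin d → ℝ} (hx : x ∈ S.ancestorSet k) (u : Fin j → ℝ) :
    S.spaceOp k j ψ (x, u) =
      ∫⁻ t, ENNReal.ofReal (S.α k j (S.y k) x (Fin.snoc (α := fun _ => ℝ) u t)) *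
        ψ (x, Fin.snoc (α := fun _ => ℝ) u t) := by
  have hq : Measurable fun t => ENNReal.ofReal (S.q k j x u t) :=
    ((S.q_measurable k j hk hj).comp (measurable_prodMk_left (x := (x, u)))).ennreal_ofReal
  have hG : Measurable fun t : ℝ =>
      ENNReal.ofReal (S.G k j x (Fin.snoc (α := fun _ => ℝ) u t)) *
        ψ (x, Fin.snoc (α := fun _ => ℝ) u t) :=
    (S.measurable_spaceOp_integrand hk hj hψ).comp (measurable_prodMk_left (x := (x, u)))
  refine (lintegral_withDensity_eq_lintegral_mul _ hq hG).trans ?_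
  refine lintegral_congr fun t => ?_
  rw [Pi.mul_apply, ← mul_assoc, ← ENNReal.ofReal_mul (S.q_nonneg k j hk hj x u t)]
  congr 2
  simp only [G, Fin.snoc_castSucc, Fin.snoc_last]
  -- Where `q` vanishes the support condition gives `α = 0`; elsewhere `q * (α / q) = α`. That
  -- condition at time `1` concerns `x0` only, hence the hypothesis `hx`.
  by_cases h0 : S.q k j x u t = 0
  · rw [h0, S.α_support k j hk hj x u t hx h0, zero_mul]
  · field_simp

theorem measurable_prod_factor {k : ℕ} (hk : 1 ≤ k) {j : ℕ} (hj : j ≤ d) (x : Fin d → ℝ) :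
    Measurable fun u : Fin j → ℝ => ∏ i : Fin j, ENNReal.ofReal
      (S.α k i (S.y k) x fun m : Fin (i.1 + 1) => u (Fin.castLE i.2 m)) := by
  refine Finset.measurable_prod _ fun i _ => Measurable.ennreal_ofReal ?_
  exact (S.α_measurable k i hk (i.2.trans_le hj)).comp
    (f := fun u : Fin j → ℝ => (x, fun m : Fin (i.1 + 1) => u (Fin.castLE i.2 m)))
    (by fun_prop)

theorem spaceOps_eq {k : ℕ} (hk : 1 ≤ k) {j : ℕ} (hj : j ≤ d) {ψ : LocalParticle d j → ℝ≥0∞}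
    (hψ : Measurable ψ) {x : Fin d → ℝ} (hx : x ∈ S.ancestorSet k) :
    S.spaceOps k j ψ x = ∫⁻ u : Fin j → ℝ, (∏ i : Fin j, ENNReal.ofReal
      (S.α k i (S.y k) x fun m : Fin (i.1 + 1) => u (Fin.castLE i.2 m))) * ψ (x, u) := by
  induction j with
  | zero =>
    have hm : Measurable fun u : Fin 0 → ℝ => ψ (x, u) := hψ.comp measurable_prodMk_left
    simp only [spaceOps, Finset.univ_eq_empty, Finset.prod_empty, one_mul]
    rw [volume_pi, Measure.pi_of_empty (fun _ => volume) Fin.elim0, lintegral_dirac' _ hm]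
  | succ j ih =>
    have hm : Measurable fun u : Fin (j + 1) → ℝ => (∏ i : Fin (j + 1), ENNReal.ofReal
        (S.α k i (S.y k) x fun m : Fin (i.1 + 1) => u (Fin.castLE i.2 m))) * ψ (x, u) :=
      (S.measurable_prod_factor hk hj x).mul (hψ.comp measurable_prodMk_left)
    rw [spaceOps, ih (by omega) (S.measurable_spaceOp hk hj hψ), lintegral_pi_snoc hm]
    refine lintegral_congr fun u => ?_
    rw [S.spaceOp_eq hk hj hψ hx, ← lintegral_const_mul]
    · refine lintegral_congr fun t => ?_
      rw [← mul_assoc, Fin.prod_univ_castSucc]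
      congr 2
      · refine Finset.prod_congr rfl fun i _ => ?_
        congr 2
        ext m
        exact (Fin.snoc_castSucc (α := fun _ => ℝ) t u (Fin.castLE i.2 m)).symm
    · have hs : Measurable fun t : ℝ => (x, (Fin.snoc (α := fun _ => ℝ) u t : Fin (j + 1) → ℝ)) :=
        measurable_const.prodMk (measurable_snoc measurable_const measurable_id)
      exact ((S.α_measurable k j hk hj).comp hs).ennreal_ofReal.mul (hψ.comp hs)

theorem timeOp_eq {k : ℕ} (hk : 1 ≤ k) {ψ : (Fin d → ℝ) → ℝ≥0∞} (hψ : Measurable ψ)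
    {x : Fin d → ℝ} (hx : x ∈ S.ancestorSet k) :
    S.timeOp k ψ x = ∫⁻ x', ENNReal.ofReal (S.g x' (S.y k) * S.f x x') * ψ x' := by
  refine (S.spaceOps_eq hk le_rfl (hψ.comp measurable_snd) hx).trans ?_
  refine lintegral_congr fun x' => ?_
  rw [S.factor k hk x x' hx,
    ENNReal.ofReal_prod_of_nonneg fun (i : Fin d) _ => S.α_nonneg k i hk i.2 _ _]
  rfl

theorem jointDensity_nonneg {n : ℕ} (x : Fin n → Fin d → ℝ) : 0 ≤ S.jointDensity x :=
  Finset.prod_nonneg fun _ _ => mul_nonneg (S.g_nonneg _ _) (S.f_nonneg _ _)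

theorem measurable_path {n : ℕ} (k : Fin (n + 1)) :
    Measurable fun x : Fin n → Fin d → ℝ => S.path x k := by
  refine Fin.cases ?_ (fun k => ?_) k
  · exact measurable_const
  · exact measurable_pi_apply k

theorem measurable_jointDensity {n : ℕ} :
    Measurable (S.jointDensity : (Fin n → Fin d → ℝ) → ℝ) :=
  Finset.measurable_prod _ fun k _ =>
    ((S.g_measurable _).comp (S.measurable_path _)).mul
      (S.f_measurable.comp
        ((S.measurable_path k.castSucc).prodMk (S.measurable_path k.succ)))

theorem path_snoc {n : ℕ} (x : Fin n → Fin d → ℝ) (v : Fin d → ℝ) :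
    S.path (Fin.snoc (α := fun _ => Fin d → ℝ) x v) =
      Fin.snoc (α := fun _ => Fin d → ℝ) (S.path x) v :=
  Fin.cons_snoc_eq_snoc_cons _ _ _

theorem jointDensity_snoc {n : ℕ} (x : Fin n → Fin d → ℝ) (v : Fin d → ℝ) :
    S.jointDensity (Fin.snoc (α := fun _ => Fin d → ℝ) x v) =
      S.jointDensity x * (S.g v (S.y (n + 1)) * S.f (S.path x (Fin.last n)) v) := by
  rw [jointDensity, Fin.prod_univ_castSucc, path_snoc]
  simp only [Fin.snoc_castSucc, Fin.succ_last, Fin.snoc_last, Fin.val_last, Fin.val_castSucc,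
    Fin.succ_castSucc]
  rfl

theorem path_last_mem {n : ℕ} (x : Fin n → Fin d → ℝ) :
    S.path x (Fin.last n) ∈ S.ancestorSet (n + 1) := by
  intro h
  obtain rfl : n = 0 := by omega
  rfl

/-- Again a backward recursion: `timeOp (n + 1)` integrates out the last state, and what remains is
the same formula at time `n`. -/
theorem timeOps_eq (n : ℕ) {ψ : (Fin d → ℝ) → ℝ≥0∞} (hψ : Measurable ψ) :
    S.timeOps n ψ = ∫⁻ x : Fin n → Fin d → ℝ,
      ENNReal.ofReal (S.jointDensity x) * ψ (S.path x (Fin.last n)) := by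
  induction n generalizing ψ with
  | zero =>
    have hc : ∀ x : Fin 0 → Fin d → ℝ,
        ENNReal.ofReal (S.jointDensity x) * ψ (S.path x (Fin.last 0)) = ψ S.x0 := by
      intro x
      simp [jointDensity, path]
    simp only [hc, timeOps]
    rw [volume_pi, Measure.pi_of_empty (fun _ => volume) Fin.elim0, lintegral_const,
      measure_univ, mul_one]
  | succ n ih =>
    have hm : Measurable fun x : Fin (n + 1) → Fin d → ℝ =>
        ENNReal.ofReal (S.jointDensity x) * ψ (S.path x (Fin.last (n + 1))) :=
      S.measurable_jointDensity.ennreal_ofReal.mul (hψ.comp (S.measurable_path _))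
    rw [timeOps, ih (S.measurable_timeOp (by omega) hψ), lintegral_pi_snoc hm]
    refine lintegral_congr fun x => ?_
    rw [S.timeOp_eq (by omega) hψ (S.path_last_mem x), ← lintegral_const_mul]
    · refine lintegral_congr fun v => ?_
      rw [jointDensity_snoc, path_snoc, Fin.snoc_last,
        ENNReal.ofReal_mul (S.jointDensity_nonneg x), mul_assoc]
    · exact (((S.g_measurable _).mul
        (S.f_measurable.comp measurable_prodMk_left)).ennreal_ofReal).mul hψ

end Model

/-! ### Convergence in probability -/

/-- Chebyshev's inequality from a bound on the second moment. -/
theorem meas_ge_le_of_second_moment {Ω : Type*} [MeasurableSpace Ω] {μ : Measure Ω}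
    [IsProbabilityMeasure μ] {Y : Ω → ℝ} (hY : Measurable Y) (hY0 : ∀ᵐ ω ∂μ, 0 ≤ Y ω) {c : ℝ}
    (hc : 0 ≤ c) {K : ℝ≥0∞} (h1 : ∫⁻ ω, ENNReal.ofReal (Y ω) ∂μ = ENNReal.ofReal c)
    (h2 : ∫⁻ ω, ENNReal.ofReal (Y ω) ^ 2 ∂μ ≤ ENNReal.ofReal c ^ 2 + K) {ε : ℝ} (hε : 0 < ε) :
    μ {ω | ε ≤ |Y ω - c|} ≤ K / ENNReal.ofReal (ε ^ 2) := by
  -- The square is expanded with the cross term moved to the left, so that no subtraction occurs in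
  -- `ℝ≥0∞`; the finite cross term is cancelled after integration.
  have hpt : ∀ᵐ ω ∂μ, ENNReal.ofReal ((Y ω - c) ^ 2) +
      2 * ENNReal.ofReal c * ENNReal.ofReal (Y ω) =
      ENNReal.ofReal (Y ω) ^ 2 + ENNReal.ofReal c ^ 2 := by
    filter_upwards [hY0] with ω hω
    rw [← ENNReal.ofReal_ofNat 2, ← ENNReal.ofReal_mul (by norm_num),
      ← ENNReal.ofReal_mul (by positivity), ← ENNReal.ofReal_add (by positivity) (by positivity),
      ← ENNReal.ofReal_pow hω, ← ENNReal.ofReal_pow hc,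
      ← ENNReal.ofReal_add (by positivity) (by positivity)]
    congr 1
    ring
  have hV : ∫⁻ ω, ENNReal.ofReal ((Y ω - c) ^ 2) ∂μ ≤ K := by
    have h := lintegral_congr_ae hpt
    rw [lintegral_add_right _ (by fun_prop), lintegral_const_mul _ (by fun_prop), h1,
      lintegral_add_right _ measurable_const, lintegral_const, measure_univ, mul_one] at h
    have h3 : ∫⁻ ω, ENNReal.ofReal ((Y ω - c) ^ 2) ∂μ + 2 * ENNReal.ofReal c * ENNReal.ofReal c ≤
        K + 2 * ENNReal.ofReal c * ENNReal.ofReal c := by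
      rw [h]
      calc _ ≤ ENNReal.ofReal c ^ 2 + K + ENNReal.ofReal c ^ 2 := by gcongr
        _ = _ := by ring
    exact (ENNReal.add_le_add_iff_right (by finiteness)).1 h3
  have hsub : {ω | ε ≤ |Y ω - c|} ⊆
      {ω | ENNReal.ofReal (ε ^ 2) ≤ ENNReal.ofReal ((Y ω - c) ^ 2)} := by
    intro ω hω
    refine ENNReal.ofReal_le_ofReal ?_
    rw [← sq_abs (Y ω - c)]
    exact pow_le_pow_left₀ hε.le hω 2
  calc μ {ω | ε ≤ |Y ω - c|}
      ≤ μ {ω | ENNReal.ofReal (ε ^ 2) ≤ ENNReal.ofReal ((Y ω - c) ^ 2)} := measure_mono hsub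
    _ ≤ (∫⁻ ω, ENNReal.ofReal ((Y ω - c) ^ 2) ∂μ) / ENNReal.ofReal (ε ^ 2) :=
        meas_ge_le_lintegral_div (by fun_prop)
          (by rw [Ne, ENNReal.ofReal_eq_zero, not_le]; positivity) ENNReal.ofReal_ne_top
    _ ≤ K / ENNReal.ofReal (ε ^ 2) := by gcongr

section InProbability

variable {Ω : ℕ → Type*} [∀ N, MeasurableSpace (Ω N)] {P : ∀ N, Measure (Ω N)}
  {T T' Z : ∀ N, Ω N → ℝ} {a b : ℝ}

/-- Comparing errors rather than values allows the variables and the limit to be shifted by the same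
constant. -/
theorem TendstoInProbability.congr' (h : TendstoInProbability P T a)
    (hT : ∀ᶠ N in atTop, ∀ ω, T N ω - a = T' N ω - b) : TendstoInProbability P T' b := by
  intro ε hε
  refine (h ε hε).congr' ?_
  filter_upwards [hT] with N hN
  simp only [hN]

/-- The quotient of two sequences that converge in probability. -/
theorem TendstoInProbability.of_mul (hZT : TendstoInProbability P (fun N ω => Z N ω * T N ω) a)
    (hZ : TendstoInProbability P Z b) (hb : 0 < b) : TendstoInProbability P T (a / b) := by
  intro ε hε
  set r := a / b with hr
  have ha : a = r * b := by rw [hr]; field_simp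
  have hden : 0 < 1 + |r| := by positivity
  -- The first bound keeps `Z > b / 2`. With the second, `Z * |T - r| < δ * (1 + |r|) ≤ ε * b / 2`,
  -- which excludes `|T - r| ≥ ε`.
  set δ := min (b / 2) (ε * b / 2 / (1 + |r|)) with hδ
  have hδ0 : 0 < δ := lt_min (by positivity) (by positivity)
  have hδ1 : δ ≤ b / 2 := min_le_left _ _
  have hδ2 : δ * (1 + |r|) ≤ ε * b / 2 := by
    rw [← le_div_iff₀ hden]; exact min_le_right _ _
  have hlim : Tendsto (fun N => P N {ω | δ ≤ |Z N ω * T N ω - a|} + P N {ω | δ ≤ |Z N ω - b|})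
      atTop (𝓝 0) := by
    simpa using (hZT δ hδ0).add (hZ δ hδ0)
  refine tendsto_of_tendsto_of_tendsto_of_le_of_le tendsto_const_nhds hlim (fun _ => zero_le)
    fun N => (measure_mono ?_).trans (measure_union_le _ _)
  intro ω hω
  by_contra hcon
  simp only [Set.mem_union, Set.mem_ofPred_eq, not_or, not_le] at hcon hω
  obtain ⟨h1, h2⟩ := hcon
  have hZpos : b / 2 < Z N ω := by
    have := (abs_lt.1 h2).1
    linarith
  have heq : Z N ω * (T N ω - r) = (Z N ω * T N ω - a) - r * (Z N ω - b) := by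
    rw [ha]; ring
  have hle : Z N ω * |T N ω - r| < ε * b / 2 := by
    calc Z N ω * |T N ω - r| = |Z N ω * (T N ω - r)| := by
          rw [abs_mul, abs_of_pos (lt_trans (by positivity) hZpos)]
      _ ≤ |Z N ω * T N ω - a| + |r * (Z N ω - b)| := by rw [heq]; exact abs_sub _ _
      _ < δ + |r| * δ := by
          rw [abs_mul]
          have : |r| * |Z N ω - b| ≤ |r| * δ := by gcongr
          linarith
      _ = δ * (1 + |r|) := by ring
      _ ≤ ε * b / 2 := hδ2
  have hge : b / 2 * ε ≤ Z N ω * |T N ω - r| :=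
    mul_le_mul hZpos.le hω hε.le ((half_pos hb).trans hZpos).le
  linarith

end InProbability

/-! ### The estimates of the algorithm as real numbers -/

section Estimates

variable {d M N n : ℕ}

theorem filterEstimate_eq (φ : (Fin d → ℝ) → ℝ) (s : GlobalState d M N n) :
    filterEstimate φ s = (1 / (N : ℝ)) * ∑ i, (1 / (M : ℝ)) * ∑ l, φ (s.2 i l) := by
  rw [filterEstimate, Finset.sum_comm, ← Finset.mul_sum, ← mul_assoc, one_div_mul_one_div]

theorem filterEstimate_add_const (hN : 0 < N) (hM : 0 < M) (φ : (Fin d → ℝ) → ℝ) (c : ℝ)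
    (s : GlobalState d M N n) :
    filterEstimate (fun x => φ x + c) s = filterEstimate φ s + c := by
  have hN' : (N : ℝ) ≠ 0 := by positivity
  have hM' : (M : ℝ) ≠ 0 := by positivity
  simp only [filterEstimate, Finset.sum_add_distrib, Finset.sum_const, Finset.card_univ,
    Fintype.card_fin, nsmul_eq_mul]
  field_simp

theorem filterEstimate_one (hN : 0 < N) (hM : 0 < M) (s : GlobalState d M N n) :
    filterEstimate (fun _ => 1) s = 1 := by
  have h := filterEstimate_add_const hN hM (fun _ => 0) 1 s
  simpa [filterEstimate] using h

theorem filterEstimate_nonneg {φ : (Fin d → ℝ) → ℝ} (hφ : ∀ x, 0 ≤ φ x)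
    (s : GlobalState d M N n) : 0 ≤ filterEstimate φ s := by
  rw [filterEstimate_eq]
  exact average_nonneg fun i => average_nonneg fun l => hφ _

theorem measurable_filterEstimate {φ : (Fin d → ℝ) → ℝ} (hφ : Measurable φ) :
    Measurable (filterEstimate φ : GlobalState d M N n → ℝ) := by
  unfold filterEstimate
  fun_prop

theorem measurable_normConstEstimate :
    Measurable (normConstEstimate : GlobalState d M N n → ℝ) := by
  unfold normConstEstimate
  fun_prop

theorem normConstEstimate_nonneg {s : GlobalState d M N n} (hs : ∀ k i, 0 ≤ s.1 k i) :
    0 ≤ normConstEstimate s :=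
  Finset.prod_nonneg fun k _ => average_nonneg (hs k)

/-- Links the moment bounds to the real estimates; nonnegativity of the weights is needed because
`ENNReal.ofReal` truncates. -/
theorem unnormEstimate_ofReal {φ : (Fin d → ℝ) → ℝ} (hφ : ∀ x, 0 ≤ φ x)
    {s : GlobalState d M N n} (hs : ∀ k i, 0 ≤ s.1 k i) :
    unnormEstimate (fun x => ENNReal.ofReal (φ x)) s =
      ENNReal.ofReal (normConstEstimate s * filterEstimate φ s) := by
  rw [ENNReal.ofReal_mul (normConstEstimate_nonneg hs), normConstEstimate,
    ofReal_prod_average hs, filterEstimate_eq,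
    ofReal_average fun i => average_nonneg fun l => hφ _]
  simp only [ofReal_average fun _ => hφ _]
  rfl

end Estimates

/-! ### Limits of the estimates -/

namespace Model

variable {d dy : ℕ} {S : Model d dy} {C : ℕ → ℝ}

/-- The bounded weights make the joint density integrable; no integrability of `f` or `g` is
assumed. -/
theorem timeOps_ne_top (hC : S.WeightBound C) (n : ℕ) {ψ : (Fin d → ℝ) → ℝ≥0∞} {B : ℝ≥0∞}
    (hB' : B ≠ ∞) (hB : ∀ x ∈ S.ancestorSet (n + 1), ψ x ≤ B) : S.timeOps n ψ ≠ ∞ := by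
  induction n generalizing ψ B with
  | zero => exact ne_top_of_le_ne_top hB' (hB _ fun _ => rfl)
  | succ n ih =>
    exact ih (B := ENNReal.ofReal (C (n + 1)) ^ d * B) (ENNReal.mul_ne_top (by simp) hB')
      fun x hx => timeOp_le hC (by omega) (fun x => hB x (S.mem_ancestorSet_add_two n x)) hx

variable (S) in
/-- The integral of `φ` against the unnormalized filter at time `n`. -/
noncomputable def unnormFilter (n : ℕ) (φ : (Fin d → ℝ) → ℝ) : ℝ :=
  ∫ x : Fin n → Fin d → ℝ, φ (S.path x (Fin.last n)) * S.jointDensity x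

theorem unnormFilter_one (n : ℕ) : S.unnormFilter n (fun _ => 1) = S.normConst n := by
  simp [unnormFilter, normConst]

theorem lintegral_unnormFilter {n : ℕ} {φ : (Fin d → ℝ) → ℝ} (hφ : Measurable φ)
    (hφ0 : ∀ x, 0 ≤ φ x) :
    ∫⁻ x : Fin n → Fin d → ℝ,
      ENNReal.ofReal (φ (S.path x (Fin.last n)) * S.jointDensity x) =
      S.timeOps n fun x => ENNReal.ofReal (φ x) := by
  rw [S.timeOps_eq n hφ.ennreal_ofReal]
  refine lintegral_congr fun x => ?_
  rw [ENNReal.ofReal_mul (hφ0 _), mul_comm]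

theorem integrable_unnormFilter (hC : S.WeightBound C) (n : ℕ) {φ : (Fin d → ℝ) → ℝ}
    (hφ : Measurable φ) (hφ0 : ∀ x, 0 ≤ φ x) {B : ℝ} (hB : ∀ x, φ x ≤ B) :
    Integrable fun x : Fin n → Fin d → ℝ => φ (S.path x (Fin.last n)) * S.jointDensity x := by
  have hm : Measurable fun x : Fin n → Fin d → ℝ =>
      φ (S.path x (Fin.last n)) * S.jointDensity x :=
    (hφ.comp (S.measurable_path _)).mul S.measurable_jointDensity
  refine (lintegral_ofReal_ne_top_iff_integrable hm.aestronglyMeasurable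
    (ae_of_all _ fun x => mul_nonneg (hφ0 _) (S.jointDensity_nonneg x))).1 ?_
  rw [lintegral_unnormFilter hφ hφ0]
  exact timeOps_ne_top hC n (B := ENNReal.ofReal B) ENNReal.ofReal_ne_top
    fun x _ => ENNReal.ofReal_le_ofReal (hB x)

theorem timeOps_ofReal (hC : S.WeightBound C) (n : ℕ) {φ : (Fin d → ℝ) → ℝ}
    (hφ : Measurable φ) (hφ0 : ∀ x, 0 ≤ φ x) {B : ℝ} (hB : ∀ x, φ x ≤ B) :
    S.timeOps n (fun x => ENNReal.ofReal (φ x)) = ENNReal.ofReal (S.unnormFilter n φ) := by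
  rw [unnormFilter, ofReal_integral_eq_lintegral_ofReal (integrable_unnormFilter hC n hφ hφ0 hB)
    (ae_of_all _ fun x => mul_nonneg (hφ0 _) (S.jointDensity_nonneg x)),
    lintegral_unnormFilter hφ hφ0]

/-- Unbiasedness and the second moment bound give, by Chebyshev, a deviation probability of at most
`K / N / ε ^ 2` with `K` independent of `N`. -/
theorem tendsto_unnormEstimate {M : ℕ} (hM : 1 ≤ M) (hC : S.WeightBound C) (n : ℕ)
    {φ : (Fin d → ℝ) → ℝ} (hφ : Measurable φ) (hφ0 : ∀ x, 0 ≤ φ x) {B : ℝ}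
    (hB : ∀ x, φ x ≤ B) :
    TendstoInProbability (fun N => S.law M N n)
      (fun _ s => normConstEstimate s * filterEstimate φ s) (S.unnormFilter n φ) := by
  have : Nonempty (Fin M) := Fin.pos_iff_nonempty.1 hM
  obtain ⟨K, hK, h⟩ := lintegral_law_unnormEstimate_sq_le M hC n hφ.ennreal_ofReal
    (B := ENNReal.ofReal B) ENNReal.ofReal_ne_top fun x _ => ENNReal.ofReal_le_ofReal (hB x)
  intro ε hε
  have hlim : Tendsto (fun N : ℕ => K / N / ENNReal.ofReal (ε ^ 2)) atTop (𝓝 0) := by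
    have h1 : Tendsto (fun N : ℕ => K / (N : ℝ≥0∞)) atTop (𝓝 0) := by
      simpa using ENNReal.Tendsto.const_div ENNReal.tendsto_nat_nhds_top (Or.inr hK)
    have hε' : ENNReal.ofReal (ε ^ 2) ≠ 0 := by
      rw [Ne, ENNReal.ofReal_eq_zero, not_le]; positivity
    simpa using ENNReal.Tendsto.div_const h1 (Or.inr hε')
  refine tendsto_of_tendsto_of_tendsto_of_le_of_le' tendsto_const_nhds hlim
    (Eventually.of_forall fun _ => zero_le) ?_
  filter_upwards [eventually_ge_atTop 1] with N hN
  have hN' : Nonempty (Fin N) := Fin.pos_iff_nonempty.1 hN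
  have := S.isProbabilityMeasure_law (M := M) (N := N) n
  have hae : ∀ᵐ s ∂(S.law M N n), unnormEstimate (fun x => ENNReal.ofReal (φ x)) s =
      ENNReal.ofReal (normConstEstimate s * filterEstimate φ s) := by
    filter_upwards [ae_law hC n] with s hs
    exact unnormEstimate_ofReal hφ0 fun k i => (hs.1 k i).1
  refine meas_ge_le_of_second_moment
    (Y := fun s => normConstEstimate s * filterEstimate φ s) (measurable_normConstEstimate.mul (measurable_filterEstimate hφ)) ?_
    (integral_nonneg fun x => mul_nonneg (hφ0 _) (S.jointDensity_nonneg x)) ?_ ?_ hε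
  · filter_upwards [ae_law hC n] with s hs
    exact mul_nonneg (normConstEstimate_nonneg fun k i => (hs.1 k i).1)
      (filterEstimate_nonneg hφ0 s)
  · rw [← lintegral_congr_ae hae, lintegral_law_unnormEstimate hC n hφ.ennreal_ofReal,
      timeOps_ofReal hC n hφ hφ0 hB]
    rfl
  · have h2 := h N hN'
    rw [timeOps_ofReal hC n hφ hφ0 hB] at h2
    refine le_trans (le_of_eq ?_) h2
    refine lintegral_congr_ae ?_
    filter_upwards [hae] with s hs
    rw [hs]

theorem tendsto_normConstEstimate {M : ℕ} (hM : 1 ≤ M) (hC : S.WeightBound C) (n : ℕ) :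
    TendstoInProbability (fun N => S.law M N n) (fun _ => normConstEstimate)
      (S.normConst n) := by
  refine (tendsto_unnormEstimate hM hC n (φ := fun _ => 1) measurable_const (fun _ => zero_le_one)
    (B := 1) fun _ => le_rfl).congr' ?_
  -- For `N = 0` the estimate of the constant `1` is `0`, so the identity holds only eventually.
  filter_upwards [eventually_ge_atTop 1] with N hN s
  rw [filterEstimate_one hN hM, mul_one, unnormFilter_one]

theorem filter_add_const (hC : S.WeightBound C) {n : ℕ} (hn : 0 < S.normConst n)
    {φ : (Fin d → ℝ) → ℝ} (hφ : Measurable φ) {B : ℝ} (hB : ∀ x, |φ x| ≤ B) :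
    S.filter n (fun x => φ x + B) = S.filter n φ + B := by
  have h1 := integrable_unnormFilter hC n (φ := fun x => φ x + B) (hφ.add_const B)
    (fun x => by linarith [neg_le_of_abs_le (hB x)]) (B := 2 * B)
    fun x => by linarith [le_of_abs_le (hB x)]
  have h2 := (integrable_unnormFilter hC n (φ := fun _ => 1) measurable_const
    (fun _ => zero_le_one) (B := 1) fun _ => le_rfl).const_mul B
  have h3 : S.unnormFilter n φ = S.unnormFilter n (fun x => φ x + B) - B * S.normConst n := by
    rw [← unnormFilter_one, unnormFilter, unnormFilter, unnormFilter, ← integral_const_mul,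
      ← integral_sub h1 h2]
    congr 1 with x
    ring
  change S.unnormFilter n (fun x => φ x + B) / S.normConst n =
    S.unnormFilter n φ / S.normConst n + B
  rw [h3]
  field_simp
  ring

theorem tendsto_filterEstimate {M : ℕ} (hM : 1 ≤ M) (hC : S.WeightBound C) {n : ℕ}
    (hn : 0 < S.normConst n) {φ : (Fin d → ℝ) → ℝ} (hφ : Measurable φ)
    (hφb : ∃ B : ℝ, ∀ x, |φ x| ≤ B) :
    TendstoInProbability (fun N => S.law M N n) (fun _ => filterEstimate φ)
      (S.filter n φ) := by
  obtain ⟨B, hB⟩ := hφb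
  -- `φ + B` is nonnegative and bounded by `2 * B`, so the quotient argument applies; the shift is
  -- then removed from the estimate and the limit alike.
  have h : TendstoInProbability (fun N => S.law M N n)
      (fun _ => filterEstimate fun x => φ x + B) (S.filter n fun x => φ x + B) :=
    (tendsto_unnormEstimate hM hC n (φ := fun x => φ x + B) (hφ.add_const B)
      (fun x => by linarith [neg_le_of_abs_le (hB x)]) (B := 2 * B)
      fun x => by linarith [le_of_abs_le (hB x)]).of_mul
      (tendsto_normConstEstimate hM hC n) hn
  refine h.congr' ?_
  filter_upwards [eventually_ge_atTop 1] with N hN s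
  rw [filterEstimate_add_const hN hM, filter_add_const hC hn hφ hB]
  ring

theorem exists_weightBound (hG1 : ∀ j < d, ∃ C : ℝ, ∀ u, |S.G 1 j S.x0 u| ≤ C)
    (hG : ∀ n, 2 ≤ n → ∀ j < d, ∃ C : ℝ, ∀ x u, |S.G n j x u| ≤ C) :
    ∃ C : ℕ → ℝ, S.WeightBound C := by
  have h : ∀ k, ∃ c : ℝ, 1 ≤ k → ∀ j < d, ∀ x ∈ S.ancestorSet k, ∀ u, S.G k j x u ≤ c := by
    intro k
    have hj : ∀ j : Fin d, ∃ c : ℝ, 1 ≤ k → ∀ x ∈ S.ancestorSet k, ∀ u, S.G k j x u ≤ c := by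
      intro j
      -- Below `2` only `k = 1` carries a claim, and there the ancestor is `x0`. A common bound over
      -- `j` exists because there are finitely many coordinates.
      rcases Nat.lt_or_ge k 2 with hk | hk
      · obtain ⟨c, hc⟩ := hG1 j j.2
        refine ⟨c, fun hk1 x hx u => ?_⟩
        obtain rfl : k = 1 := by omega
        rw [hx rfl]
        exact le_of_abs_le (hc u)
      · obtain ⟨c, hc⟩ := hG k hk j j.2
        exact ⟨c, fun _ x _ u => le_of_abs_le (hc x u)⟩
    choose c hc using hj
    obtain ⟨c', hc'⟩ := Finite.exists_le c
    exact ⟨c', fun hk j hj x hx u => (hc ⟨j, hj⟩ hk x hx u).trans (hc' _)⟩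
  choose C hC using h
  exact ⟨C, hC⟩

end Model

end SpaceTime

theorem mainTheorem1 {d dy M : ℕ} (hd : 1 ≤ d) (hM : 1 ≤ M) (S : SpaceTime.Model d dy)
    (hG1 : ∀ j < d, ∃ C : ℝ, ∀ u, |S.G 1 j S.x0 u| ≤ C)
    (hG : ∀ n, 2 ≤ n → ∀ j < d, ∃ C : ℝ, ∀ x u, |S.G n j x u| ≤ C)
    (φ : (Fin d → ℝ) → ℝ) (hφ : Measurable φ) (hφb : ∃ C : ℝ, ∀ x, |φ x| ≤ C) :
    (∀ N n, 1 ≤ N → IsProbabilityMeasure (S.law M N n)) ∧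
    (0 < S.normConst 1 →
      SpaceTime.TendstoInProbability (fun N => S.law M N 1)
        (fun _ => SpaceTime.filterEstimate φ) (S.filter 1 φ)) ∧
    SpaceTime.TendstoInProbability (fun N => S.law M N 1)
      (fun _ => SpaceTime.normConstEstimate) (S.normConst 1) ∧
    ∀ n, 2 ≤ n →
      (0 < S.normConst n →
        SpaceTime.TendstoInProbability (fun N => S.law M N n)
          (fun _ => SpaceTime.filterEstimate φ) (S.filter n φ)) ∧
      SpaceTime.TendstoInProbability (fun N => S.law M N n)
        (fun _ => SpaceTime.normConstEstimate) (S.normConst n) := by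
  obtain ⟨C, hC⟩ := SpaceTime.Model.exists_weightBound hG1 hG
  refine ⟨fun N n hN => ?_,
    fun h => SpaceTime.Model.tendsto_filterEstimate hM hC h hφ hφb,
    SpaceTime.Model.tendsto_normConstEstimate hM hC 1,
    fun n _ => ⟨fun h => SpaceTime.Model.tendsto_filterEstimate hM hC h hφ hφb,
      SpaceTime.Model.tendsto_normConstEstimate hM hC n⟩⟩
  have : Nonempty (Fin M) := Fin.pos_iff_nonempty.1 hM
  have : Nonempty (Fin N) := Fin.pos_iff_nonempty.1 hN
  exact S.isProbabilityMeasure_law n
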